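/- Let $k\ge 2$, let $\mathcal A=\{1,\dots,k\}$, and let $\Sigma=\mathcal A^{\mathbb N}$ (sequences $w=w_0w_1w_2\dots$) carry the lexicographic order and the product topology. Let $\sigma$ be the shift map, $\sigma(w)_r=w_{r+1}$; a sequence $w\in\Sigma$ is called maximal if $\sigma^r(w)\le w$ for all $r\ge 0$. Let $$\Delta=\Big\{\alpha\in\mathbb R_{\ge 0}^k : \alpha_k>0,\ \sum_{i=1}^k\alpha_i=1\Big\}.$$ For $\alpha\in\Delta$ let $\mathcal M(\alpha)$ be the set of maximal $w\in\Sigma$ such that, for each letter $i$, the proportion of the letter $i$ in the word $w_0w_1\dots w_{r-1}$ tends to $\alpha_i$ as $r\to\infty$. Define $J:\Delta\to\mathbb N$ by $J(\alpha)=\lfloor \alpha_1/\alpha_k\rfloor$, and $K:\Delta\to\Delta$ by $$K(\alpha)=\left(\frac{\alpha_2}{1-\alpha_1},\dots,\frac{\alpha_{k-1}}{1-\alpha_1},\ \frac{\alpha_1-n\alpha_k}{1-\alpha_1},\ \frac{(n+1)\alpha_k-\alpha_1}{1-\alpha_1}\right),\qquad n=J(\alpha),$$ and let $\Phi(\alpha)\in\mathbb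 N^{\mathbb N}$ be the itinerary $\Phi(\alpha)_r=J(K^r(\alpha))$, $r\ge 0$. For $n\in\mathbb N$ let $\Lambda_n$ be the substitution $$i\mapsto i+1\ \ (1\le i\le k-2),\qquad k-1\mapsto k\,1^{n+1},\qquad k\mapsto k\,1^n,$$ acting on finite words letter by letter. For $\mathbf n=(n_0,n_1,\dots)\in\mathbb N^{\mathbb N}$ let $$S(\mathbf n)=\lim_{r\to\infty}\overline{(\Lambda_{n_0}\circ\Lambda_{n_1}\circ\cdots\circ\Lambda_{n_r})(k)}\in\Sigma,$$ where $\overline W=WWW\dots$ (this limit exists, since each word is an initial subword of the next). Then for every $\alpha\in\Delta$ the set $\mathcal M(\alpha)$ is non-empty, and its infimum in the lexicographic order is $$\inf\mathcal M(\alpha)=S(\Phi(\alpha)).$$ -/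

import Mathlib

namespace Infimax

/-- The alphabet with `k = m + 2` letters (so `k ≥ 2` is arbitrary). The letter written `i` in
`{1, …, k}` is the element of `Fin (m + 2)` with value `i - 1`: the letter `1` is `0`, the letter
`k - 1` has value `m`, and the letter `k` is `Fin.last (m + 1)`. Vectors of `ℝ ^ k` are indexed in
the same way. -/
abbrev Letter (m : ℕ) : Type := Fin (m + 2)

/-- The smallest letter `1`. -/
abbrev one (m : ℕ) : Letter m := 0

/-- The largest letter `k`. -/
abbrev top (m : ℕ) : Letter m := Fin.last (m + 1)

/-- The space of infinite sequences of letters, with the product topology. The lexicographic order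
is the one of `Lex (ℕ → Letter m)`, reached through `toLex`. -/
abbrev Seq (m : ℕ) : Type := ℕ → Letter m

/-- The shift map. -/
def shift {m : ℕ} (w : Seq m) : Seq m := fun r => w (r + 1)

/-- A sequence is maximal if it is the lexicographically greatest element of its shift orbit. -/
def IsMaximalSeq {m : ℕ} (w : Seq m) : Prop :=
  ∀ r : ℕ, toLex (shift^[r] w) ≤ toLex w

/-- The word `w_0 w_1 … w_{r-1}`. -/
def initialWord {m : ℕ} (w : Seq m) (r : ℕ) : List (Letter m) := (List.range r).map w

/-- The vector of proportions of the letters in a (nonempty) finite word. -/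
noncomputable def proportions {m : ℕ} (W : List (Letter m)) : Letter m → ℝ :=
  fun i => (W.count i : ℝ) / (W.length : ℝ)

/-- The simplex of vectors with nonnegative entries of sum `1`, without the face on which the last
coordinate vanishes. -/
def simplex (m : ℕ) : Set (Letter m → ℝ) :=
  {α | (∀ i, 0 ≤ α i) ∧ 0 < α (top m) ∧ ∑ i, α i = 1}

/-- The sequences with asymptotic letter proportions `α`. -/
def seqsWithProportions {m : ℕ} (α : Letter m → ℝ) : Set (Seq m) :=
  {w | Filter.Tendsto (fun r => proportions (initialWord w r)) Filter.atTop (nhds α)}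

/-- The maximal sequences with asymptotic letter proportions `α`. -/
def maximalSeqs {m : ℕ} (α : Letter m → ℝ) : Set (Seq m) :=
  {w | IsMaximalSeq w ∧ w ∈ seqsWithProportions α}

/-- `J(α)` is the integer part of `α_1 / α_k`. -/
noncomputable def J {m : ℕ} (α : Letter m → ℝ) : ℕ := ⌊α (one m) / α (top m)⌋₊

/-- `K_n(α) = (α_2, …, α_{k-1}, α_1 - n α_k, (n + 1) α_k - α_1) / (1 - α_1)`. -/
noncomputable def Kn {m : ℕ} (n : ℕ) (α : Letter m → ℝ) : Letter m → ℝ := fun i =>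
  if h : (i : ℕ) < m then α ⟨(i : ℕ) + 1, by omega⟩ / (1 - α (one m))
  else if (i : ℕ) = m then (α (one m) - (n : ℝ) * α (top m)) / (1 - α (one m))
  else (((n : ℝ) + 1) * α (top m) - α (one m)) / (1 - α (one m))

/-- The continued fraction map; on the simplex it is a self-map (`K_mapsTo`). -/
noncomputable def K {m : ℕ} (α : Letter m → ℝ) : Letter m → ℝ := Kn (J α) α

/-- The itinerary `Φ(α)_r = J(K^r(α))`. -/
noncomputable def itinerary {m : ℕ} (α : Letter m → ℝ) : ℕ → ℕ := fun r => J (K^[r] α)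

/-- The images of the letters under the substitution `Λ_n`: `i ↦ i + 1` for `1 ≤ i ≤ k - 2`,
`k - 1 ↦ k 1^(n+1)`, and `k ↦ k 1^n`. -/
def substLetter {m : ℕ} (n : ℕ) (i : Letter m) : List (Letter m) :=
  if h : (i : ℕ) < m then [⟨(i : ℕ) + 1, by omega⟩]
  else if (i : ℕ) = m then top m :: List.replicate (n + 1) (one m)
  else top m :: List.replicate n (one m)

/-- The substitution `Λ_n` acting on finite words. -/
def subst {m : ℕ} (n : ℕ) (W : List (Letter m)) : List (Letter m) := W.flatMap (substLetter n)

/-- The composition `Λ_{n_0} ∘ Λ_{n_1} ∘ ⋯ ∘ Λ_{n_r}` acting on finite words. -/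
def substComp {m : ℕ} (n : ℕ → ℕ) : ℕ → List (Letter m) → List (Letter m)
  | 0, W => subst (n 0) W
  | r + 1, W => substComp n r (subst (n (r + 1)) W)

/-- The infinite repetition `W W W …` of a (nonempty) word `W`. -/
def repeatWord {m : ℕ} (W : List (Letter m)) : Seq m :=
  fun j => W.getD (j % W.length) (top m)

/-- `S(n)` is the limit, as `r → ∞`, of the infinite repetition of the word
`(Λ_{n_0} ∘ ⋯ ∘ Λ_{n_r})(k)`. The limit exists (`tendsto_S`). -/
noncomputable def S {m : ℕ} (n : ℕ → ℕ) : Seq m :=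
  Filter.limUnder Filter.atTop (fun r => repeatWord (substComp n r [top m]))

theorem K_mapsTo (m : ℕ) : Set.MapsTo (K (m := m)) (simplex m) (simplex m) := by
  rintro α ⟨h0, hk, hs⟩
  have hs' := hs
  rw [Fin.sum_univ_succ, Fin.sum_univ_castSucc] at hs'
  simp only [Fin.succ_last] at hs'
  have hpos : 0 ≤ ∑ i : Fin m, α (Fin.succ (Fin.castSucc i)) := Finset.sum_nonneg fun i _ => h0 _
  have hlt : 0 < 1 - α 0 := by
    have : 0 < α (Fin.last (m + 1)) := hk
    linarith
  have hJ1 : (J α : ℝ) * α (top m) ≤ α (one m) := by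
    have := Nat.floor_le (div_nonneg (h0 (one m)) hk.le)
    rwa [le_div_iff₀ hk] at this
  have hJ2 : α (one m) < ((J α : ℝ) + 1) * α (top m) := by
    have := Nat.lt_floor_add_one (α (one m) / α (top m))
    rwa [div_lt_iff₀ hk] at this
  refine ⟨fun i => ?_, ?_, ?_⟩
  · unfold K Kn
    split_ifs
    · exact div_nonneg (h0 _) hlt.le
    · exact div_nonneg (by linarith) hlt.le
    · exact div_nonneg (by linarith) hlt.le
  · have h1 : ¬ (m + 1 < m) := by omega
    have h2 : ¬ (m + 1 = m) := by omega
    simp only [K, Kn, Fin.val_last, h1, h2, dite_false, if_false]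
    exact div_pos (by linarith) hlt
  · rw [Fin.sum_univ_castSucc, Fin.sum_univ_castSucc]
    have e1 : ∀ i : Fin m, K α (Fin.castSucc (Fin.castSucc i))
        = α (Fin.succ (Fin.castSucc i)) / (1 - α 0) := by
      intro i
      have hi : (i : ℕ) < m := i.2
      simp only [K, Kn, Fin.val_castSucc, hi, dite_true]
      rfl
    have e2 : K α (Fin.castSucc (Fin.last m))
        = (α 0 - (J α : ℝ) * α (Fin.last (m + 1))) / (1 - α 0) := by
      simp [K, Kn]
    have e3 : K α (Fin.last (m + 1))
        = (((J α : ℝ) + 1) * α (Fin.last (m + 1)) - α 0) / (1 - α 0) := by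
      simp [K, Kn]
    rw [Finset.sum_congr rfl fun i _ => e1 i, e2, e3, ← Finset.sum_div, ← add_div, ← add_div,
      div_eq_one_iff_eq hlt.ne']
    linarith

theorem subst_append {m : ℕ} (n : ℕ) (V W : List (Letter m)) :
    subst n (V ++ W) = subst n V ++ subst n W := by
  simp [subst]

theorem substComp_append {m : ℕ} (n : ℕ → ℕ) (r : ℕ) (V W : List (Letter m)) :
    substComp n r (V ++ W) = substComp n r V ++ substComp n r W := by
  induction r generalizing V W with
  | zero => exact subst_append _ _ _
  | succ r ih => simp only [substComp, subst_append, ih]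

theorem subst_top {m : ℕ} (n : ℕ) :
    subst n [top m] = [top m] ++ List.replicate n (one m) := by
  simp [subst, substLetter]

theorem substComp_top_prefix {m : ℕ} (n : ℕ → ℕ) (r : ℕ) :
    substComp n r [top m] <+: substComp n (r + 1) [top m] := by
  rw [substComp, subst_top, substComp_append]
  exact List.prefix_append _ _

/-- The defining limit of `S(n)` exists, in the product topology. -/
theorem tendsto_S {m : ℕ} (n : ℕ → ℕ) :
    Filter.Tendsto (fun r => repeatWord (substComp n r [top m])) Filter.atTop (nhds (S n)) := by
  refine tendsto_nhds_limUnder ?_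
  set V : ℕ → List (Letter m) := fun r => substComp n r [top m] with hV
  have hmono : ∀ r s, r ≤ s → V r <+: V s := by
    intro r s h
    induction h with
    | refl => exact List.prefix_rfl
    | step _ ih => exact ih.trans (substComp_top_prefix n _)
  have key : ∀ j : ℕ, ∃ c : Letter m, ∀ᶠ r in Filter.atTop, repeatWord (V r) j = c := by
    intro j
    by_cases h : ∃ r, j < (V r).length
    · obtain ⟨r, hr⟩ := h
      refine ⟨(V r)[j], Filter.eventually_atTop.2 ⟨r, fun s hs => ?_⟩⟩
      have hp := hmono r s hs
      have hl : j < (V s).length := hr.trans_le hp.length_le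
      simp only [repeatWord, Nat.mod_eq_of_lt hl]
      rw [List.getD_eq_getElem _ _ hl]
      exact (hp.getElem hr).symm
    · push Not at h
      obtain ⟨R, hR⟩ : ∃ R, ∀ s, (V s).length ≤ (V R).length := by
        have hb : (Set.range fun r => (V r).length).Finite :=
          (Set.finite_Iic j).subset (by rintro _ ⟨r, rfl⟩; exact h r)
        obtain ⟨_, ⟨R, rfl⟩, hmax⟩ := Set.exists_max_image _ id hb ⟨_, 0, rfl⟩
        exact ⟨R, fun s => hmax _ ⟨s, rfl⟩⟩
      refine ⟨repeatWord (V R) j, Filter.eventually_atTop.2 ⟨R, fun s hs => ?_⟩⟩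
      rw [(hmono R s hs).eq_of_length_le (hR s)]
  choose c hc using key
  refine ⟨c, tendsto_pi_nhds.2 fun j => ?_⟩
  exact tendsto_nhds_of_eventually_eq (hc j)

end Infimax

open Filter Topology

namespace Infimax

variable {m : ℕ}

/-! The substitution `Λ_n` preserves the lexicographic order (`substSeq_mono`), keeps maximality for
sequences beginning with `k` (`IsMaximalSeq.substSeq`), and turns letter proportions `Kn n α` into
`α` (`substSeq_mem_seqsWithProportions`), since `Kn n` is projectively the inverse of its incidence
matrix. Hence a maximal sequence with proportions `K^[r] α` is carried by the first `r`
substitutions into `maximalSeqs α` (`substSeqComp_mem_maximalSeqs`). Maximal sequences with any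
proportions in the simplex exist (`maximalSeqs_nonempty`), and a suitable initial run of `k` makes
the image agree with `S` as far as desired (`exists_agree_S`). So `S` is approximated from within
the set, and no lower bound exceeds it.

For the lower bound a converse is needed (`exists_desubstitution`): any `w` with proportions `α`,
maximal or not, admits some `w'` with proportions `K α` such that the image of every tail of `w'` is
at most some tail of `w`. To find `w'`, put `n = J α` and suppose that each `k` in `w` is followed
by `1^n`. Each block `k 1^n` lowers `excess` by one and each further `1` raises it by one, so
surplus letters `1` can be matched with `k`s like brackets. Matched `k`s are decoded to `k - 1` and
unmatched ones to `k`, and the matching gives both the right densities and the right inequality. If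
some `k` is not followed by `1^n`, the tail starting there already exceeds every image under `Λ_n`.
Iterating `r` times and choosing a tail of `w'` with a long enough run of `k` shows that a maximal
`w` is not below `S`. -/

/-! ### Shifts and the lexicographic order. -/

theorem shift_iterate_apply (w : Seq m) (a j : ℕ) : shift^[a] w j = w (a + j) := by
  induction a generalizing w with
  | zero => simp
  | succ a ih => rw [Function.iterate_succ_apply, ih, shift]; congr 1; omega

theorem lex_lt_iff {v w : Seq m} :
    toLex v < toLex w ↔ ∃ i, (∀ j < i, v j = w j) ∧ v i < w i := Iff.rfl

/-- A coinduction principle for the lexicographic order. -/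
theorem lex_le_of_coinduction (R : Seq m → Seq m → Prop)
    (hR : ∀ v w, R v w → toLex v < toLex w ∨
      ∃ L, 0 < L ∧ (∀ i < L, v i = w i) ∧ R (shift^[L] v) (shift^[L] w))
    {v w : Seq m} (h : R v w) : toLex v ≤ toLex w := by
  by_contra hlt
  obtain ⟨d, heq, hd⟩ := lex_lt_iff.1 (not_le.1 hlt)
  clear hlt
  induction d using Nat.strong_induction_on generalizing v w with
  | _ d ih =>
    rcases hR v w h with h1 | ⟨L, hL, hag, hR'⟩
    · exact lt_asymm h1 (lex_lt_iff.2 ⟨d, heq, hd⟩)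
    · have hLd : L ≤ d := by
        by_contra hc
        rw [hag d (by omega)] at hd
        exact lt_irrefl _ hd
      -- The agreeing block is removed, which moves the first difference from `d` to `d - L`.
      refine ih (d - L) (by omega) hR' (fun j hj => ?_) ?_
      · simp only [shift_iterate_apply]
        exact heq _ (by omega)
      · simp only [shift_iterate_apply]
        rwa [show L + (d - L) = d by omega]

/-- This compares blocks: after a leading `k`, the letter `1` is the smallest possible continuation,
so any other letter among the next `t` places wins. -/
theorem lex_lt_of_ones {v w : Seq m} (t : ℕ) (hw : w 0 = top m)
    (hv : v 0 ≠ top m ∨ ∀ i, 0 < i → i ≤ t → v i = one m)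
    (h : ∃ i, 0 < i ∧ i ≤ t ∧ w i ≠ one m) : toLex v < toLex w := by
  rw [lex_lt_iff]
  by_cases h0 : v 0 = top m
  · have hv := hv.resolve_left (fun h => h h0)
    classical
    obtain ⟨hi0, hit, hi⟩ := Nat.find_spec h
    refine ⟨Nat.find h, fun j hj => ?_, ?_⟩
    · have := Nat.find_min h hj
      rcases Nat.eq_zero_or_pos j with rfl | hj0
      · rw [h0, hw]
      · rw [hv j hj0 (by omega)]
        by_contra hc
        exact this ⟨hj0, by omega, fun h => hc h.symm⟩
    · rw [hv _ hi0 hit]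
      exact Fin.pos_of_ne_zero hi
  · exact ⟨0, by simp, by rw [hw]; exact lt_of_le_of_ne (Fin.le_last _) h0⟩

/-! ### Initial words -/

@[simp] theorem length_initialWord (w : Seq m) (r : ℕ) : (initialWord w r).length = r := by
  simp [initialWord]

theorem initialWord_succ (w : Seq m) (r : ℕ) :
    initialWord w (r + 1) = initialWord w r ++ [w r] := by
  simp [initialWord, List.range_succ]

theorem initialWord_succ' (w : Seq m) (r : ℕ) :
    initialWord w (r + 1) = w 0 :: initialWord (shift w) r := by
  simp [initialWord, List.range_succ_eq_map, shift, Function.comp_def]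

theorem initialWord_prefix (w : Seq m) {r s : ℕ} (h : r ≤ s) :
    initialWord w r <+: initialWord w s := by
  induction s, h using Nat.le_induction with
  | base => exact List.prefix_rfl
  | succ s _ ih => exact ih.trans (by rw [initialWord_succ]; exact List.prefix_append _ _)

theorem count_initialWord (w : Seq m) (i : Letter m) (r : ℕ) :
    (initialWord w r).count i = Nat.count (fun p => w p = i) r := by
  induction r with
  | zero => simp [initialWord]
  | succ r ih =>
    rw [initialWord_succ, List.count_append, ih, Nat.count_succ, List.count_singleton]
    simp

theorem mem_seqsWithProportions {w : Seq m} {α : Letter m → ℝ} :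
    w ∈ seqsWithProportions α ↔
      ∀ i, Tendsto (fun r : ℕ => (Nat.count (fun p => w p = i) r : ℝ) / r) atTop (𝓝 (α i)) := by
  simp only [seqsWithProportions, Set.mem_ofPred_eq, tendsto_pi_nhds, proportions,
    count_initialWord, length_initialWord]

/-- The finite word `W` is an initial word of the sequence `w`. -/
def HasPrefix (W : List (Letter m)) (w : Seq m) : Prop := initialWord w W.length = W

theorem hasPrefix_initialWord (w : Seq m) (r : ℕ) : HasPrefix (initialWord w r) w := by
  simp [HasPrefix]

theorem HasPrefix.getElem {W : List (Letter m)} {w : Seq m} (h : HasPrefix W w) {j : ℕ}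
    (hj : j < W.length) : W[j] = w j := by
  have : W[j] = (initialWord w W.length)[j]'(by simpa using hj) := by
    congr 1; exact h.symm
  rw [this]; simp [initialWord]

theorem hasPrefix_of_getElem {W : List (Letter m)} {w : Seq m}
    (h : ∀ j (hj : j < W.length), W[j] = w j) : HasPrefix W w :=
  List.ext_getElem (by simp) fun j _ h2 => by rw [h j h2]; simp [initialWord]

/-! ### Substitutions acting on sequences -/

/-- The substitution `Λ_n` acting on sequences. -/
def substSeq (n : ℕ) (w : Seq m) : Seq m := fun p => (subst n (initialWord w (p + 1))).getD p (top m)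

/-- The length of the image of a letter under `Λ_n`. -/
def blockLength (n : ℕ) (i : Letter m) : ℕ := (substLetter n i).length

theorem blockLength_pos (n : ℕ) (i : Letter m) : 0 < blockLength n i := by
  unfold blockLength substLetter; split_ifs <;> simp

theorem length_le_length_subst (n : ℕ) (W : List (Letter m)) :
    W.length ≤ (subst n W).length := by
  induction W with
  | nil => simp
  | cons a W ih =>
    have := blockLength_pos n a
    simp only [subst, List.flatMap_cons, List.length_append, List.length_cons, blockLength] at *
    omega

theorem subst_prefix (n : ℕ) {V W : List (Letter m)} (h : V <+: W) :
    subst n V <+: subst n W := by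
  obtain ⟨U, rfl⟩ := h
  rw [subst_append]; exact List.prefix_append _ _

theorem HasPrefix.subst {W : List (Letter m)} {w : Seq m} (h : HasPrefix W w) (n : ℕ) :
    HasPrefix (Infimax.subst n W) (substSeq n w) := by
  refine hasPrefix_of_getElem fun p hp => ?_
  -- Blocks are nonempty, so `p + 1` letters produce more than `p` letters and the default value of
  -- `getD` is never read.
  have hp' : p < (Infimax.subst n (initialWord w (p + 1))).length :=
    lt_of_lt_of_le (by simp) (length_le_length_subst _ _)
  rw [substSeq, List.getD_eq_getElem _ _ hp']
  have h' : initialWord w W.length = W := h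
  rcases le_total W.length (p + 1) with hl | hl
  · have := subst_prefix n (initialWord_prefix w hl)
    rw [h'] at this
    exact this.getElem hp
  · have := subst_prefix n (initialWord_prefix w hl)
    rw [h'] at this
    exact (this.getElem hp').symm

theorem subst_initialWord_succ' (n : ℕ) (w : Seq m) (r : ℕ) :
    subst n (initialWord w (r + 1)) = substLetter n (w 0) ++ subst n (initialWord (shift w) r) := by
  rw [initialWord_succ']; simp [subst]

theorem substSeq_of_lt (n : ℕ) (w : Seq m) {p : ℕ} (hp : p < (substLetter n (w 0)).length) :
    substSeq n w p = (substLetter n (w 0))[p] := by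
  have h := (hasPrefix_initialWord w 1).subst n
  rw [subst_initialWord_succ'] at h
  have := h.getElem (j := p) (by rw [List.length_append]; omega)
  rw [← this, List.getElem_append_left hp]

theorem shift_substSeq (n : ℕ) (w : Seq m) :
    shift^[blockLength n (w 0)] (substSeq n w) = substSeq n (shift w) := by
  funext p
  rw [shift_iterate_apply]
  have h := (hasPrefix_initialWord w (p + 2)).subst n
  rw [subst_initialWord_succ'] at h
  have h2 := (hasPrefix_initialWord (shift w) (p + 1)).subst n
  have hl : p < (Infimax.subst n (initialWord (shift w) (p + 1))).length :=
    lt_of_lt_of_le (by simp) (length_le_length_subst _ _)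
  have := h.getElem (j := blockLength n (w 0) + p)
    (by rw [List.length_append]; unfold blockLength; omega)
  rw [← this, ← h2.getElem hl, List.getElem_append_right (by unfold blockLength; omega)]
  congr 1
  unfold blockLength; omega

/-! ### Blocks of the substitution, monotonicity and maximality. -/

theorem substSeq_zero_of_lt (n : ℕ) (w : Seq m) (h : (w 0 : ℕ) < m) :
    substSeq n w 0 = ⟨(w 0 : ℕ) + 1, by omega⟩ := by
  have := blockLength_pos n (w 0)
  rw [substSeq_of_lt n w this]
  simp [substLetter, h]

theorem substSeq_zero_of_le (n : ℕ) (w : Seq m) (h : m ≤ (w 0 : ℕ)) :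
    substSeq n w 0 = top m := by
  have := blockLength_pos n (w 0)
  rw [substSeq_of_lt n w this]
  simp only [substLetter, dif_neg (not_lt.2 h)]
  split_ifs <;> rfl

theorem getElem_succ_substLetter (n : ℕ) (i : Letter m) {p : ℕ}
    (hp : p + 1 < (substLetter n i).length) : (substLetter n i)[p + 1] = one m := by
  unfold substLetter at hp
  simp only [substLetter]
  split_ifs at hp ⊢
  · simp at hp
  · rw [List.getElem_cons_succ, List.getElem_replicate]
  · rw [List.getElem_cons_succ, List.getElem_replicate]

theorem substSeq_eq_one (n : ℕ) (w : Seq m) {p : ℕ} (h0 : 0 < p) (hp : p < blockLength n (w 0)) :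
    substSeq n w p = one m := by
  rw [substSeq_of_lt n w hp]
  obtain ⟨p, rfl⟩ := Nat.exists_eq_succ_of_ne_zero h0.ne'
  exact getElem_succ_substLetter n (w 0) hp

theorem substSeq_zero_ne_one (n : ℕ) (w : Seq m) : substSeq n w 0 ≠ one m := by
  rcases lt_or_ge (w 0 : ℕ) m with h | h
  · rw [substSeq_zero_of_lt n w h]; exact fun h => Nat.succ_ne_zero _ (congrArg Fin.val h)
  · rw [substSeq_zero_of_le n w h]; exact Fin.last_pos.ne'

theorem blockLength_of_lt (n : ℕ) {i : Letter m} (h : (i : ℕ) < m) : blockLength n i = 1 := by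
  simp [blockLength, substLetter, h]

theorem blockLength_of_eq (n : ℕ) {i : Letter m} (h : (i : ℕ) = m) :
    blockLength n i = n + 2 := by
  simp [blockLength, substLetter, h]

theorem blockLength_top (n : ℕ) : blockLength n (top m) = n + 1 := by
  simp [blockLength, substLetter]

theorem blockLength_le (n : ℕ) (i : Letter m) : blockLength n i ≤ n + 2 := by
  unfold blockLength substLetter; split_ifs <;> simp

theorem eq_top_of_lt {i : Letter m} (h : m < (i : ℕ)) : i = top m := by
  ext; simp only [Fin.val_last]; omega

/-- The heads of the images already differ unless the letters are `k - 1` and `k`. Then `k 1^(n+1)`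
meets `k 1^n` followed by the head of the next block, and no block begins with `1`. -/
theorem substSeq_lt_of_head_lt (n : ℕ) {v w : Seq m} (h : v 0 < w 0) :
    toLex (substSeq n v) < toLex (substSeq n w) := by
  rcases lt_or_ge (v 0 : ℕ) m with hv | hv
  · refine lex_lt_iff.2 ⟨0, by simp, ?_⟩
    rw [substSeq_zero_of_lt n v hv]
    rcases lt_or_ge (w 0 : ℕ) m with hw | hw
    · rw [substSeq_zero_of_lt n w hw]
      exact Nat.succ_lt_succ h
    · rw [substSeq_zero_of_le n w hw]
      exact Nat.succ_lt_succ hv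
  · have hlt : (v 0 : ℕ) < w 0 := h
    have hw : w 0 = top m := eq_top_of_lt (by omega)
    have hv' : (v 0 : ℕ) = m := by have := (w 0).2; omega
    refine lex_lt_of_ones (n + 1) (substSeq_zero_of_le n w (by omega))
      (Or.inr fun i h0 hi => substSeq_eq_one n v h0 (by rw [blockLength_of_eq n hv']; omega))
      ⟨n + 1, by omega, le_rfl, ?_⟩
    have := congrFun (shift_substSeq n w) 0
    rw [hw, blockLength_top, shift_iterate_apply] at this
    rw [show n + 1 = n + 1 + 0 from rfl, this]
    exact substSeq_zero_ne_one n _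

theorem substSeq_agree (n : ℕ) {v w : Seq m} (h : v 0 = w 0) {i : ℕ}
    (hi : i < blockLength n (v 0)) : substSeq n v i = substSeq n w i := by
  rw [substSeq_of_lt n v hi, substSeq_of_lt n w (h ▸ hi)]
  simp only [h]

theorem substSeq_mono (n : ℕ) {v w : Seq m} (h : toLex v ≤ toLex w) :
    toLex (substSeq n v) ≤ toLex (substSeq n w) := by
  refine lex_le_of_coinduction
    (fun x y => ∃ v w : Seq m, toLex v ≤ toLex w ∧ x = substSeq n v ∧ y = substSeq n w)
    ?_ ⟨v, w, h, rfl, rfl⟩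
  rintro _ _ ⟨v, w, h, rfl, rfl⟩
  have key : v 0 < w 0 ∨ (v 0 = w 0 ∧ toLex (shift v) ≤ toLex (shift w)) := by
    rcases h.eq_or_lt with h | h
    · have h : v = w := toLex.injective h
      subst h; exact Or.inr ⟨rfl, le_rfl⟩
    · obtain ⟨d, hd, hlt⟩ := lex_lt_iff.1 h
      rcases d with _ | d
      · exact Or.inl hlt
      · exact Or.inr ⟨hd 0 (by omega),
          (lex_lt_iff.2 ⟨d, fun j hj => hd (j + 1) (by omega), hlt⟩).le⟩
  rcases key with h | ⟨h0, h⟩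
  · exact Or.inl (substSeq_lt_of_head_lt n h)
  · refine Or.inr ⟨blockLength n (v 0), blockLength_pos _ _, fun i hi => substSeq_agree n h0 hi,
      shift v, shift w, h, shift_substSeq n v, ?_⟩
    rw [h0, shift_substSeq]

/-- A position lies either inside a block, where only `1` occurs, or at the start of one. -/
theorem substSeq_tail (n : ℕ) (w : Seq m) (N : ℕ) :
    substSeq n w N = one m ∨ ∃ j, shift^[N] (substSeq n w) = substSeq n (shift^[j] w) := by
  induction N using Nat.strong_induction_on generalizing w with
  | _ N ih =>
    rcases Nat.eq_zero_or_pos N with rfl | hN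
    · exact Or.inr ⟨0, rfl⟩
    rcases lt_or_ge N (blockLength n (w 0)) with h | h
    · exact Or.inl (substSeq_eq_one n w hN h)
    · obtain ⟨N, rfl⟩ := Nat.exists_eq_add_of_le h
      have hpos := blockLength_pos n (w 0)
      have hs := shift_substSeq n w
      rcases ih N (by omega) (shift w) with h1 | ⟨j, h1⟩
      · left
        rw [← hs, shift_iterate_apply] at h1
        exact h1
      · right
        refine ⟨j + 1, ?_⟩
        rw [Nat.add_comm, Function.iterate_add_apply, hs, h1, Function.iterate_succ_apply]

theorem IsMaximalSeq.substSeq {w : Seq m} (hw : IsMaximalSeq w) (h0 : w 0 = top m) (n : ℕ) :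
    IsMaximalSeq (Infimax.substSeq n w) := by
  intro N
  rcases substSeq_tail n w N with h | ⟨j, h⟩
  · refine (lex_lt_iff.2 ⟨0, by simp, ?_⟩).le
    have h1 : shift^[N] (Infimax.substSeq n w) 0 = one m := by
      rw [shift_iterate_apply]; exact h
    have h2 := substSeq_zero_of_le n w (by simp [h0])
    exact h1.trans_lt (Fin.last_pos.trans_eq h2.symm)
  · rw [h]; exact substSeq_mono n (hw j)

/-! ### Asymptotic proportions -/

theorem tendsto_div_of_bounded_discrepancy {c : ℕ → ℝ} {a B : ℝ} (N : ℕ)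
    (h : ∀ r ≥ N, |c r - r * a| ≤ B) :
    Tendsto (fun r : ℕ => c r / r) atTop (𝓝 a) := by
  rw [tendsto_iff_norm_sub_tendsto_zero]
  refine squeeze_zero' (Eventually.of_forall fun _ => norm_nonneg _) ?_
    (tendsto_const_div_atTop_nhds_zero_nat B)
  filter_upwards [eventually_ge_atTop N, eventually_gt_atTop 0] with r hr hr0
  have hr0' : (0 : ℝ) < r := by exact_mod_cast hr0
  rw [Real.norm_eq_abs, show c r / r - a = (c r - r * a) / r by field_simp, abs_div,
    abs_of_pos hr0']
  exact div_le_div_of_nonneg_right (h r hr) hr0'.le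

theorem exists_between_of_strictMono {len : ℕ → ℕ} (hlen : StrictMono len) (h0 : len 0 = 0)
    (N : ℕ) : ∃ j, len j ≤ N ∧ N < len (j + 1) := by
  induction N with
  | zero => exact ⟨0, h0.le, by have := hlen Nat.zero_lt_one; rw [zero_add]; omega⟩
  | succ N ih =>
    obtain ⟨j, h1, h2⟩ := ih
    rcases (show N + 1 ≤ len (j + 1) from h2).lt_or_eq with h | h
    · exact ⟨j, by omega, h⟩
    · exact ⟨j + 1, h.ge, h ▸ hlen (Nat.lt_succ_self _)⟩

/-- Convergence of the averages of a counting function along a sequence with bounded gaps. -/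
theorem tendsto_div_of_bounded_gaps {f len : ℕ → ℕ} {C : ℕ} {a : ℝ} (hf0 : f 0 = 0)
    (hmono : Monotone f) (hf : ∀ N d, f (N + d) ≤ f N + d) (hlen : StrictMono len)
    (h0 : len 0 = 0) (hC : ∀ j, len (j + 1) ≤ len j + C)
    (h : Tendsto (fun j => (f (len j) : ℝ) / len j) atTop (𝓝 a)) :
    Tendsto (fun N : ℕ => (f N : ℝ) / N) atTop (𝓝 a) := by
  choose j hj1 hj2 using exists_between_of_strictMono hlen h0
  have hjt : Tendsto j atTop atTop := by
    refine tendsto_atTop_atTop.2 fun b => ⟨len b, fun N hN => ?_⟩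
    by_contra hc
    have := hlen.monotone (show j N + 1 ≤ b by omega)
    have := hj2 N
    omega
  have hdiff : Tendsto (fun N : ℕ => (f N : ℝ) / N - (f (len (j N)) : ℝ) / len (j N))
      atTop (𝓝 0) := by
    refine squeeze_zero_norm' ?_ (tendsto_const_div_atTop_nhds_zero_nat (2 * C : ℝ))
    filter_upwards [eventually_gt_atTop C] with N hN
    have hL1 := hj1 N
    have hL2 : N ≤ len (j N) + C := (hj2 N).le.trans (hC _)
    generalize len (j N) = L at hL1 hL2
    have hLpos : 0 < L := by omega
    -- Moving `d ≤ C` places beyond a sampled length `L` changes the average by at most a multiple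
    -- of `C / N`.
    obtain ⟨d, rfl⟩ := Nat.exists_eq_add_of_le hL1
    have h1 : (f L : ℝ) ≤ f (L + d) := by exact_mod_cast hmono (Nat.le_add_right L d)
    have h2 : (f (L + d) : ℝ) ≤ f L + d := by exact_mod_cast hf L d
    have h3 : (f L : ℝ) ≤ L := by
      have := hf 0 L
      rw [hf0] at this
      exact_mod_cast (by simpa using this : f L ≤ L)
    have hd : (d : ℝ) ≤ C := by exact_mod_cast (by omega : d ≤ C)
    have hL : (0 : ℝ) < L := by exact_mod_cast hLpos
    have hd0 : (0 : ℝ) ≤ d := Nat.cast_nonneg _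
    have hf0' : (0 : ℝ) ≤ f L := Nat.cast_nonneg _
    push_cast
    have hq : (f L : ℝ) / L ≤ 1 := (div_le_one hL).2 h3
    have hq0 : 0 ≤ (f L : ℝ) / L := div_nonneg hf0' hL.le
    have e : (f (L + d) : ℝ) / (L + d) - f L / L
        = ((f (L + d) - f L) - f L / L * d) / (L + d) := by
      field_simp; ring
    rw [e, Real.norm_eq_abs, abs_div, abs_of_pos (by positivity : (0 : ℝ) < L + d)]
    refine div_le_div_of_nonneg_right ?_ (by positivity)
    rw [abs_le]
    constructor <;> nlinarith
  have := hdiff.add (h.comp hjt)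
  simpa using this

theorem count_le_count_add (p : ℕ → Prop) [DecidablePred p] (N d : ℕ) :
    Nat.count p (N + d) ≤ Nat.count p N + d := by
  rw [Nat.count_add]
  exact Nat.add_le_add_left (Nat.count_le _) _

/-! ### Letter counts under substitution -/

theorem count_subst_succ (n : ℕ) (W : List (Letter m)) {v : ℕ} (hv : v < m) :
    (subst n W).count ⟨v + 1, by omega⟩ = W.count ⟨v, by omega⟩ := by
  induction W with
  | nil => simp [subst]
  | cons a W ih =>
    have h : (substLetter n a).count (⟨v + 1, by omega⟩ : Letter m)
        = if a = ⟨v, by omega⟩ then 1 else 0 := by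
      unfold substLetter
      split_ifs <;>
        simp_all [List.count_cons, List.count_replicate, Fin.ext_iff] <;> omega
    rw [List.count_cons, ← ih]
    simp only [subst, List.flatMap_cons, List.count_append, h, beq_iff_eq]
    omega

theorem count_subst_top (n : ℕ) (W : List (Letter m)) :
    (subst n W).count (top m) = W.count ⟨m, by omega⟩ + W.count (top m) := by
  induction W with
  | nil => simp [subst]
  | cons a W ih =>
    have h : (substLetter n a).count (top m)
        = (if a = ⟨m, by omega⟩ then 1 else 0) + if a = top m then 1 else 0 := by
      have := a.2
      unfold substLetter
      split_ifs <;>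
        simp_all [List.count_replicate, Fin.ext_iff] <;> omega
    simp only [subst, List.flatMap_cons, List.count_append, h, beq_iff_eq, List.count_cons] at ih ⊢
    omega

theorem count_subst_one (n : ℕ) (W : List (Letter m)) :
    (subst n W).count (one m) = (n + 1) * W.count ⟨m, by omega⟩ + n * W.count (top m) := by
  induction W with
  | nil => simp [subst]
  | cons a W ih =>
    have h : (substLetter n a).count (one m)
        = (n + 1) * (if a = ⟨m, by omega⟩ then 1 else 0) + n * if a = top m then 1 else 0 := by
      have := a.2
      unfold substLetter
      split_ifs with h1 h2 h3 h4 h5 <;>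
        simp only [List.count_cons, List.count_nil, List.count_replicate, beq_iff_eq, Fin.ext_iff,
          Fin.val_last, Fin.val_zero, mul_one, mul_zero] at * <;>
        simp <;> omega
    simp only [subst, List.flatMap_cons, List.count_append, h, beq_iff_eq, List.count_cons] at ih ⊢
    rw [ih]; ring

theorem length_subst (n : ℕ) (W : List (Letter m)) :
    (subst n W).length = W.length + (n + 1) * W.count ⟨m, by omega⟩ + n * W.count (top m) := by
  induction W with
  | nil => simp [subst]
  | cons a W ih =>
    have h : (substLetter n a).length
        = 1 + (n + 1) * (if a = ⟨m, by omega⟩ then 1 else 0) + n * if a = top m then 1 else 0 := by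
      have := a.2
      unfold substLetter
      split_ifs <;> simp_all [Fin.ext_iff] <;> omega
    simp only [subst, List.flatMap_cons, List.length_append, h, beq_iff_eq, List.count_cons,
      List.length_cons] at ih ⊢
    rw [ih]; ring

theorem simplex_one_lt {α : Letter m → ℝ} (hα : α ∈ simplex m) : α (one m) < 1 := by
  obtain ⟨h0, hk, hs⟩ := hα
  have : α (one m) + α (top m) ≤ ∑ i, α i := by
    have hne : one m ≠ top m := Fin.last_pos.ne
    rw [← Finset.sum_pair hne]
    exact Finset.sum_le_sum_of_subset_of_nonneg (Finset.subset_univ _) fun i _ _ => h0 i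
  linarith

theorem Kn_of_lt (n : ℕ) (α : Letter m → ℝ) {v : ℕ} (hv : v < m) :
    Kn n α ⟨v, by omega⟩ = α ⟨v + 1, by omega⟩ / (1 - α (one m)) := by
  simp [Kn, hv]

theorem Kn_eq (n : ℕ) (α : Letter m → ℝ) :
    Kn n α ⟨m, by omega⟩ = (α (one m) - n * α (top m)) / (1 - α (one m)) := by
  simp [Kn]

theorem Kn_top (n : ℕ) (α : Letter m → ℝ) :
    Kn n α (top m) = ((n + 1) * α (top m) - α (one m)) / (1 - α (one m)) := by
  simp [Kn]

theorem letter_cases (i : Letter m) :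
    i = one m ∨ (∃ (v : ℕ) (hv : v < m), i = ⟨v + 1, by omega⟩) ∨ i = top m := by
  have := i.2
  rcases Nat.eq_zero_or_pos (i : ℕ) with h | h
  · exact Or.inl (Fin.ext h)
  · rcases lt_or_ge m (i : ℕ) with h' | h'
    · exact Or.inr (Or.inr (eq_top_of_lt h'))
    · exact Or.inr (Or.inl ⟨i - 1, by omega, Fin.ext (by simp; omega)⟩)

/-- Both the letter counts and the length of the image of `j` letters are linear in the counts of
the preimage, which gives the limits along block ends. Block lengths are bounded by `n + 2`, so the
limits extend to all positions. -/
theorem substSeq_mem_seqsWithProportions {α : Letter m → ℝ} (hα : α (one m) < 1) {n : ℕ}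
    {w : Seq m} (hw : w ∈ seqsWithProportions (Kn n α)) :
    substSeq n w ∈ seqsWithProportions α := by
  rw [mem_seqsWithProportions] at hw ⊢
  set len : ℕ → ℕ := fun j => (subst n (initialWord w j)).length with hlen
  have hD : 0 < 1 - α (one m) := by linarith
  have hsucc : ∀ j, len (j + 1) = len j + blockLength n (w j) := by
    intro j
    simp [hlen, initialWord_succ, blockLength, subst]
  have hcount : ∀ i j, Nat.count (fun p => substSeq n w p = i) (len j)
      = (subst n (initialWord w j)).count i := by
    intro i j
    rw [← count_initialWord]
    have : initialWord (substSeq n w) (len j) = _ := (hasPrefix_initialWord w j).subst n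
    rw [this]
  have hlenlim : Tendsto (fun j : ℕ => (len j : ℝ) / j) atTop (𝓝 (1 / (1 - α (one m)))) := by
    have h1 := (((hw ⟨m, by omega⟩).const_mul ((n : ℝ) + 1)).add
      ((hw (top m)).const_mul (n : ℝ))).const_add 1
    rw [Kn_eq, Kn_top] at h1
    have e : 1 / (1 - α (one m)) = 1 + (((n : ℝ) + 1) * ((α (one m) - n * α (top m)) / (1 - α (one m)))
      + n * (((n + 1) * α (top m) - α (one m)) / (1 - α (one m)))) := by
      field_simp; ring
    rw [e]
    refine h1.congr' ?_
    filter_upwards [eventually_gt_atTop 0] with j hj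
    have hj' : (0 : ℝ) < j := by exact_mod_cast hj
    simp only [hlen, length_subst, length_initialWord, count_initialWord]
    push_cast
    field_simp
    ring
  have hclim : ∀ i, Tendsto (fun j : ℕ => ((subst n (initialWord w j)).count i : ℝ) / j) atTop
      (𝓝 (α i / (1 - α (one m)))) := by
    intro i
    rcases letter_cases i with rfl | ⟨v, hv, rfl⟩ | rfl
    · have h1 := ((hw ⟨m, by omega⟩).const_mul ((n : ℝ) + 1)).add
        ((hw (top m)).const_mul (n : ℝ))
      rw [Kn_eq, Kn_top] at h1
      have e : α (one m) / (1 - α (one m)) = ((n : ℝ) + 1) * ((α (one m) - n * α (top m)) / (1 - α (one m)))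
        + n * (((n + 1) * α (top m) - α (one m)) / (1 - α (one m))) := by
        field_simp; ring
      rw [e]
      refine h1.congr fun j => ?_
      simp only [count_subst_one, count_initialWord]
      push_cast
      ring
    · have h1 := hw ⟨v, by omega⟩
      rw [Kn_of_lt n α hv] at h1
      refine h1.congr fun j => ?_
      rw [count_subst_succ n _ hv, count_initialWord]
    · have h1 := (hw ⟨m, by omega⟩).add (hw (top m))
      rw [Kn_eq, Kn_top] at h1
      have e : α (top m) / (1 - α (one m)) = (α (one m) - n * α (top m)) / (1 - α (one m))
        + ((n + 1) * α (top m) - α (one m)) / (1 - α (one m)) := by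
        field_simp; ring
      rw [e]
      refine h1.congr fun j => ?_
      simp only [count_subst_top, count_initialWord]
      push_cast
      ring
  intro i
  refine tendsto_div_of_bounded_gaps (len := len) (C := n + 2) (by simp) (Nat.count_monotone _)
    (count_le_count_add _) (strictMono_nat_of_lt_succ fun j => ?_) (by simp [hlen, subst, initialWord])
    (fun j => ?_) ?_
  · rw [hsucc]; exact Nat.lt_add_of_pos_right (blockLength_pos _ _)
  · rw [hsucc]; exact Nat.add_le_add_left (blockLength_le _ _) _
  · have h1 := (hclim i).div hlenlim (by positivity)
    rw [show α i / (1 - α (one m)) / (1 / (1 - α (one m))) = α i by field_simp] at h1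
    refine h1.congr' ?_
    filter_upwards [eventually_gt_atTop 0] with j hj
    have hj' : (0 : ℝ) < j := by exact_mod_cast hj
    rw [hcount]
    exact div_div_div_cancel_right₀ hj'.ne' _ _

/-! ### Sequences with prescribed proportions -/

/-- Greedy choice: always write a letter whose deficit `D` is largest. The deficits sum to zero, so
the largest is nonnegative and none falls below `-1`; the zero sum then bounds each of them above by
the number of letters. -/
theorem exists_seq_bounded_discrepancy {α : Letter m → ℝ} (h0 : ∀ i, 0 ≤ α i)
    (hs : ∑ i, α i = 1) :
    ∃ w : Seq m, ∀ i r, |(Nat.count (fun p => w p = i) r : ℝ) - r * α i| ≤ m + 2 := by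
  have hpick : ∀ d : Letter m → ℝ, ∃ i, ∀ j, d j ≤ d i := fun d => Finite.exists_max d
  choose pick hpick using hpick
  let D : ℕ → Letter m → ℝ := fun r => Nat.rec (fun _ => 0)
    (fun _ d => fun i => d i + α i - if i = pick d then 1 else 0) r
  have hD0 : ∀ i, D 0 i = 0 := fun i => rfl
  have hD : ∀ r i, D (r + 1) i = D r i + α i - if i = pick (D r) then 1 else 0 := fun r i => rfl
  have hsum : ∀ r, ∑ i, D r i = 0 := by
    intro r
    induction r with
    | zero => simp [hD0]
    | succ r ih =>
      simp only [hD, Finset.sum_sub_distrib, Finset.sum_add_distrib, ih, hs]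
      simp
  have hlow : ∀ r i, -1 ≤ D r i := by
    intro r
    induction r with
    | zero => intro i; rw [hD0]; norm_num
    | succ r ih =>
      intro i
      rw [hD]
      have h1 := h0 i
      split_ifs with h
      · have : 0 ≤ D r i := by
          by_contra hc
          have : ∑ j, D r j < 0 := Finset.sum_neg (fun j _ => lt_of_le_of_lt
            (h ▸ hpick (D r) j) (not_le.1 hc)) Finset.univ_nonempty
          rw [hsum] at this
          exact lt_irrefl _ this
        linarith
      · have := ih i
        linarith
  have hup : ∀ r i, D r i ≤ m + 2 := by
    intro r i
    have h1 := Finset.single_le_sum (f := fun j => D r j + 1)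
      (fun j _ => by have := hlow r j; linarith) (Finset.mem_univ i)
    simp only [Finset.sum_add_distrib, hsum] at h1
    simp at h1
    linarith
  refine ⟨fun r => pick (D r), fun i r => ?_⟩
  have hc : (Nat.count (fun p => pick (D p) = i) r : ℝ) = r * α i - D r i := by
    induction r with
    | zero => simp [hD0]
    | succ r ih =>
      rw [Nat.count_succ]
      push_cast
      rw [ih, hD]
      by_cases h : pick (D r) = i
      · simp [h]; ring
      · simp [h, Ne.symm h]; ring
  rw [hc, abs_le]
  have h1 := hlow r i
  have h2 := hup r i
  have h3 : (0 : ℝ) ≤ m := Nat.cast_nonneg _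
  constructor <;> linarith

theorem seqsWithProportions_nonempty {α : Letter m → ℝ} (hα : α ∈ simplex m) :
    (seqsWithProportions α).Nonempty := by
  obtain ⟨w, hw⟩ := exists_seq_bounded_discrepancy hα.1 hα.2.2
  exact ⟨w, mem_seqsWithProportions.2 fun i =>
    tendsto_div_of_bounded_discrepancy 0 fun r _ => hw i r⟩

/-- The initial run of `k` is longer than every run of `k` starting later. -/
theorem isMaximalSeq_of_runs {w : Seq m} {t : ℕ} (hlt : ∀ j < t, w j = top m) (h : ∀ r > 0, ∃ s < t, w (r + s) ≠ top m) : IsMaximalSeq w := by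
  intro r
  rcases Nat.eq_zero_or_pos r with rfl | hr
  · exact le_rfl
  classical
  have h := h r hr
  obtain ⟨h1, h2⟩ := Nat.find_spec h
  refine (lex_lt_iff.2 ⟨Nat.find h, fun j hj => ?_, ?_⟩).le
  · rw [shift_iterate_apply, hlt j (by omega)]
    by_contra hc
    exact Nat.find_min h hj ⟨by omega, hc⟩
  · have e : shift^[r] w (Nat.find h) = w (r + Nat.find h) := shift_iterate_apply _ _ _
    have e2 := hlt _ h1
    exact (e.trans_lt (lt_of_le_of_ne (Fin.le_last _) h2)).trans_eq e2.symm

theorem const_mem_maximalSeqs {α : Letter m → ℝ} (hα : α (top m) = 1)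
    (h : ∀ i, i ≠ top m → α i = 0) : (fun _ => top m) ∈ maximalSeqs α := by
  refine ⟨fun r => le_of_eq ?_, mem_seqsWithProportions.2 fun i => ?_⟩
  · congr 1; funext j; rw [shift_iterate_apply]
  · by_cases hi : i = top m
    · subst hi
      rw [hα]
      refine tendsto_div_of_bounded_discrepancy (B := 0) 0 fun r _ => ?_
      simp [Nat.count_true]
    · rw [h i hi]
      refine tendsto_div_of_bounded_discrepancy (B := 0) 0 fun r _ => ?_
      simp [Ne.symm hi, Nat.count_false]

theorem eq_zero_of_top_eq_one {α : Letter m → ℝ} (hα : α ∈ simplex m) (h : α (top m) = 1) :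
    ∀ i, i ≠ top m → α i = 0 := by
  obtain ⟨h0, _, hs⟩ := hα
  intro i hi
  have : α i + α (top m) ≤ ∑ j, α j := by
    rw [← Finset.sum_pair hi]
    exact Finset.sum_le_sum_of_subset_of_nonneg (Finset.subset_univ _) fun i _ _ => h0 i
  have := h0 i
  linarith

theorem maximalSeqs_nonempty {α : Letter m → ℝ} (hα : α ∈ simplex m) :
    (maximalSeqs α).Nonempty := by
  by_cases h1 : α (top m) = 1
  · exact ⟨_, const_mem_maximalSeqs h1 (eq_zero_of_top_eq_one hα h1)⟩
  have hle : ∀ i, α i ≤ 1 := fun i => by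
    rw [← hα.2.2]; exact Finset.single_le_sum (fun j _ => hα.1 j) (Finset.mem_univ i)
  have hlt : α (top m) < 1 := lt_of_le_of_ne (hle _) h1
  obtain ⟨u, hu⟩ := exists_seq_bounded_discrepancy hα.1 hα.2.2
  -- A run of `N` letters `k` in `u` would change the discrepancy of `k` by `N (1 - α_k)`, whereas
  -- two discrepancies differ by at most `2 (m + 2)`. Prefixing `k^N` to `u` therefore gives a
  -- maximal sequence.
  obtain ⟨N, hN⟩ := exists_nat_gt (2 * ((m : ℝ) + 2) / (1 - α (top m)))
  rw [div_lt_iff₀ (by linarith)] at hN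
  have hrun : ∀ a, ∃ s < N, u (a + s) ≠ top m := by
    intro a
    by_contra! hc
    have e : Nat.count (fun p => u p = top m) (a + N) = Nat.count (fun p => u p = top m) a + N := by
      rw [Nat.count_add]
      congr 1
      exact Nat.count_iff_forall.2 fun s hs => hc s hs
    have h1 := (abs_le.1 (hu (top m) (a + N))).2
    have h2 := (abs_le.1 (hu (top m) a)).1
    rw [e] at h1
    push_cast at h1
    linarith
  let w : Seq m := fun j => if j < N then top m else u (j - N)
  have hwN : ∀ j, w (N + j) = u j := fun j => by simp [w]
  have hwlt : ∀ j < N, w j = top m := fun j hj => by simp [w, hj]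
  classical
  have hex : ∃ t, w t ≠ top m := by
    obtain ⟨s, _, hs⟩ := hrun 0
    exact ⟨N + s, by rw [hwN]; simpa using hs⟩
  have hge : N ≤ Nat.find hex := by
    by_contra hc
    exact Nat.find_spec hex (hwlt _ (by omega))
  refine ⟨w, isMaximalSeq_of_runs (t := Nat.find hex)
    (fun j hj => by simpa using Nat.find_min hex hj) fun r hr => ?_, ?_⟩
  · rcases le_or_gt r (Nat.find hex) with h | h
    · exact ⟨Nat.find hex - r, by omega, by
        rw [show r + (Nat.find hex - r) = Nat.find hex by omega]; exact Nat.find_spec hex⟩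
    · obtain ⟨s, hs, h2⟩ := hrun (r - N)
      refine ⟨s, by omega, ?_⟩
      rwa [show r + s = N + (r - N + s) by omega, hwN]
  · refine mem_seqsWithProportions.2 fun i =>
      tendsto_div_of_bounded_discrepancy (B := m + 2 + 2 * N) N fun r hr => ?_
    obtain ⟨r, rfl⟩ := Nat.exists_eq_add_of_le hr
    rw [Nat.count_add]
    simp only [hwN]
    have h1 := abs_le.1 (hu i r)
    have h2 : (Nat.count (fun p => w p = i) N : ℝ) ≤ N := by exact_mod_cast Nat.count_le _
    have h3 : (0 : ℝ) ≤ (Nat.count (fun p => w p = i) N : ℝ) := Nat.cast_nonneg _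
    have h4 : (N : ℝ) * α i ≤ N := mul_le_of_le_one_right (Nat.cast_nonneg _) (hle i)
    have h5 : 0 ≤ (N : ℝ) * α i := mul_nonneg (Nat.cast_nonneg _) (hα.1 i)
    push_cast
    rw [abs_le]
    constructor <;> nlinarith

/-! ### Desubstitution -/

theorem exists_max_of_tendsto_atBot {g : ℕ → ℤ} (hg : Tendsto g atTop atBot) (q : ℕ) :
    ∃ p ≥ q, ∀ p' ≥ q, g p' ≤ g p := by
  obtain ⟨Q, hQ⟩ := eventually_atTop.1 (hg.eventually_le_atBot (g q))
  obtain ⟨p, hp, hmax⟩ := (Finset.Icc q (max q Q)).exists_max_image g ⟨q, by simp⟩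
  refine ⟨p, (Finset.mem_Icc.1 hp).1, fun p' hp' => ?_⟩
  rcases le_total p' (max q Q) with h | h
  · exact hmax p' (Finset.mem_Icc.2 ⟨hp', h⟩)
  · exact (hQ p' (le_trans (le_max_right _ _) h)).trans
      (hmax q (Finset.mem_Icc.2 ⟨le_rfl, le_max_left _ _⟩))

/-- The number of letters `1` minus `n + 1` times the number of letters `k` in the initial word
of length `q`. -/
def excess (n : ℕ) (w : Seq m) (q : ℕ) : ℤ :=
  (Nat.count (fun p => w p = one m) q : ℤ) - (n + 1) * (Nat.count (fun p => w p = top m) q : ℤ)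

theorem one_ne_top : one m ≠ top m := Fin.last_pos.ne

theorem excess_succ_one (n : ℕ) {w : Seq m} {q : ℕ} (h : w q = one m) :
    excess n w (q + 1) = excess n w q + 1 := by
  have h' : w q ≠ top m := by rw [h]; exact one_ne_top
  simp only [excess, Nat.count_succ, if_pos h, if_neg h']
  push_cast; ring

theorem excess_succ_top (n : ℕ) {w : Seq m} {q : ℕ} (h : w q = top m) :
    excess n w (q + 1) = excess n w q - (n + 1) := by
  have h' : w q ≠ one m := by rw [h]; exact one_ne_top.symm
  simp only [excess, Nat.count_succ, if_pos h, if_neg h']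
  push_cast; ring

theorem excess_succ_other (n : ℕ) {w : Seq m} {q : ℕ} (h : w q ≠ one m) (h' : w q ≠ top m) :
    excess n w (q + 1) = excess n w q := by
  simp only [excess, Nat.count_succ, if_neg h, if_neg h']
  push_cast; ring

theorem excess_block {n : ℕ} {w : Seq m}
    (hf : ∀ p, w p = top m → ∀ i, 0 < i → i ≤ n → w (p + i) = one m)
    {p : ℕ} (h : w p = top m) : excess n w (p + n + 1) = excess n w p - 1 := by
  have : ∀ t ≤ n, excess n w (p + t + 1) = excess n w p - (n + 1) + t := by
    intro t ht
    induction t with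
    | zero => simpa using excess_succ_top n h
    | succ t ih =>
      have h1 := excess_succ_one n (hf p h (t + 1) (by omega) ht)
      rw [h1, show p + (t + 1) = p + t + 1 from rfl, ih (by omega)]
      push_cast; ring
  rw [this n le_rfl]; ring

/-- The letter at `p` is a `k` such that every later excess is smaller. -/
def IsUnmatched (n : ℕ) (w : Seq m) (p : ℕ) : Prop :=
  w p = top m ∧ ∀ q > p, excess n w q < excess n w p

open Classical in
/-- The preimage letter attached to a position `p` whose letter is not `1`. -/
noncomputable def desubstLetter (n : ℕ) (w : Seq m) (p : ℕ) : Letter m :=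
  if IsUnmatched n w p then top m else ⟨(w p : ℕ) - 1, by omega⟩

/-- The sequence obtained from `w` by erasing the letters `1` and decoding each remaining letter;
a letter `k` counts as the start of `k 1^n` if it is unmatched and of `k 1^(n+1)` otherwise. -/
noncomputable def desubst (n : ℕ) (w : Seq m) : Seq m :=
  fun j => desubstLetter n w (Nat.nth (fun p => w p ≠ one m) j)

/-- The number of letters other than `1` in the initial word of length `q`. -/
abbrev countNonOne (w : Seq m) (q : ℕ) : ℕ := Nat.count (fun p => w p ≠ one m) q

theorem desubst_count (n : ℕ) {w : Seq m} {q : ℕ} (h : w q ≠ one m) :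
    desubst n w (countNonOne w q) = desubstLetter n w q := by
  rw [desubst, Nat.nth_count (p := fun p => w p ≠ one m) h]

theorem desubstLetter_eq_top_iff {n : ℕ} {w : Seq m} {p : ℕ} :
    desubstLetter n w p = top m ↔ IsUnmatched n w p := by
  unfold desubstLetter
  split_ifs with h
  · simp [h]
  · simp only [h, iff_false]
    intro hc
    have := congrArg Fin.val hc
    have h2 := (w p).2
    simp only [Fin.val_last] at this
    omega

theorem count_desubst (n : ℕ) (w : Seq m) (i : Letter m) (q : ℕ) :
    Nat.count (fun j => desubst n w j = i) (countNonOne w q)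
      = Nat.count (fun p => w p ≠ one m ∧ desubstLetter n w p = i) q := by
  induction q with
  | zero => simp [countNonOne]
  | succ q ih =>
    by_cases h : w q = one m
    · simp only [countNonOne, Nat.count_succ, h, ne_eq, not_true, if_false, false_and, add_zero]
      exact ih
    · rw [countNonOne, Nat.count_succ, if_pos h, Nat.count_succ, Nat.count_succ, ih,
        desubst_count n h]
      simp [h]

theorem countNonOne_add (w : Seq m) (q : ℕ) :
    Nat.count (fun p => w p = one m) q + countNonOne w q = q := by
  induction q with
  | zero => simp [countNonOne]
  | succ q ih =>
    rw [countNonOne] at ih ⊢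
    rw [Nat.count_succ, Nat.count_succ]
    by_cases h : w q = one m
    · rw [if_pos h, if_neg (not_not.2 h)]; omega
    · rw [if_neg h, if_pos h]; omega

theorem tendsto_excess {α : Letter m → ℝ} {w : Seq m} (hw : w ∈ seqsWithProportions α) (n : ℕ) :
    Tendsto (fun q : ℕ => (excess n w q : ℝ) / q) atTop
      (𝓝 (α (one m) - (n + 1) * α (top m))) := by
  rw [mem_seqsWithProportions] at hw
  refine ((hw (one m)).sub ((hw (top m)).const_mul ((n : ℝ) + 1))).congr fun q => ?_
  simp only [excess]
  push_cast
  ring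

theorem tendsto_excess_atBot {α : Letter m → ℝ} {w : Seq m} (hw : w ∈ seqsWithProportions α)
    {n : ℕ} (hn : α (one m) < (n + 1) * α (top m)) : Tendsto (excess n w) atTop atBot := by
  have h1 := (tendsto_excess hw n).neg_mul_atTop (by linarith) tendsto_natCast_atTop_atTop
  rw [← tendsto_intCast_atBot_iff (R := ℝ)]
  refine h1.congr' ?_
  filter_upwards [eventually_gt_atTop 0] with q hq
  have : (0 : ℝ) < q := by exact_mod_cast hq
  field_simp

/-- Let `M q` be the maximum of the excess over positions from `q` on. It drops by exactly one in
passing an unmatched `k` and is otherwise constant, so the unmatched `k`s before `q` number `M 0 - M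
q`. -/
theorem tendsto_count_unmatched {α : Letter m → ℝ} {w : Seq m} (hw : w ∈ seqsWithProportions α)
    {n : ℕ} (hn : α (one m) < (n + 1) * α (top m))
    (hf : ∀ p, w p = top m → ∀ i, 0 < i → i ≤ n → w (p + i) = one m) :
    Tendsto (fun q : ℕ =>
      (Nat.count (fun p => w p ≠ one m ∧ desubstLetter n w p = top m) q : ℝ) / q) atTop
      (𝓝 ((n + 1) * α (top m) - α (one m))) := by
  choose P hP hmax using exists_max_of_tendsto_atBot (tendsto_excess_atBot hw hn)
  have hU : ∀ q, (Nat.count (fun p => w p ≠ one m ∧ desubstLetter n w p = top m) q : ℤ)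
      = excess n w (P 0) - excess n w (P q) := by
    intro q
    induction q with
    | zero => simp
    | succ q ih =>
      rw [Nat.count_succ]
      push_cast
      rw [ih]
      have h1 : excess n w (P (q + 1)) ≤ excess n w (P q) := hmax q _ (by have := hP (q + 1); omega)
      have h2 : excess n w q ≤ excess n w (P q) := hmax q q le_rfl
      by_cases hu : IsUnmatched n w q
      · have hq1 : w q ≠ one m := by rw [hu.1]; exact one_ne_top.symm
        rw [if_pos ⟨hq1, desubstLetter_eq_top_iff.2 hu⟩]
        have h3 := excess_block hf hu.1
        have h4 := hmax (q + 1) (q + n + 1) (by omega)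
        have h5 := hu.2 (P (q + 1)) (hP (q + 1))
        have h6 : excess n w (P q) ≤ excess n w q := by
          rcases (hP q).eq_or_lt with h | h
          · rw [← h]
          · exact (hu.2 _ h).le
        omega
      · rw [if_neg fun h => hu (desubstLetter_eq_top_iff.1 h.2)]
        -- If the maximum dropped here, it would be attained only at `q`; the excess would fall at
        -- `q`, forcing an unmatched `k` there.
        have h3 : excess n w (P q) ≤ excess n w (P (q + 1)) := by
          rcases (hP q).eq_or_lt with h | h
          · rw [← h]
            by_contra! hc
            have h7 : ∀ q' > q, excess n w q' < excess n w q := fun q' hq' =>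
              lt_of_le_of_lt (hmax (q + 1) q' hq') hc
            refine hu ⟨?_, h7⟩
            have h8 := h7 (q + 1) (Nat.lt_succ_self q)
            by_contra ht
            by_cases ho : w q = one m
            · rw [excess_succ_one n ho] at h8; omega
            · rw [excess_succ_other n ho ht] at h8; omega
          · exact hmax _ _ h
        omega
  have hg := tendsto_excess hw n
  have hPt : Tendsto P atTop atTop := tendsto_atTop_mono hP tendsto_id
  have hM : Tendsto (fun q : ℕ => (excess n w (P q) : ℝ) / q) atTop
      (𝓝 (α (one m) - (n + 1) * α (top m))) := by
    -- The maximum is at least the excess at `q`. It is eventually nonpositive and `q ≤ P q`, so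
    -- dividing it by `P q` instead of `q` only increases the quotient.
    refine tendsto_of_tendsto_of_tendsto_of_le_of_le' hg (hg.comp hPt) ?_ ?_
    · filter_upwards with q
      exact div_le_div_of_nonneg_right (by exact_mod_cast hmax q q le_rfl) (Nat.cast_nonneg _)
    · filter_upwards [(tendsto_excess_atBot hw hn |>.comp hPt).eventually_le_atBot 0,
        eventually_gt_atTop 0] with q hq hq0
      have hq0' : (0 : ℝ) < q := by exact_mod_cast hq0
      have hPq : (q : ℝ) ≤ P q := by exact_mod_cast hP q
      have hq' : (excess n w (P q) : ℝ) ≤ 0 := by exact_mod_cast hq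
      simp only [Function.comp_apply]
      rw [div_le_div_iff₀ hq0' (by linarith)]
      exact mul_le_mul_of_nonpos_left hPq hq'
  have h0 := (tendsto_const_div_atTop_nhds_zero_nat (excess n w (P 0) : ℝ)).sub hM
  rw [zero_sub, neg_sub] at h0
  refine h0.congr fun q => ?_
  have := hU q
  rw [← sub_div]
  congr 1
  exact_mod_cast this.symm

theorem desubstLetter_val_of_not_unmatched {n : ℕ} {w : Seq m} {p : ℕ} (h : ¬ IsUnmatched n w p) :
    (desubstLetter n w p : ℕ) = (w p : ℕ) - 1 := by
  simp [desubstLetter, h]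

theorem infinite_top {α : Letter m → ℝ} (hk : 0 < α (top m)) {w : Seq m}
    (hw : w ∈ seqsWithProportions α) : {p | w p = top m}.Infinite := by
  intro hfin
  rw [mem_seqsWithProportions] at hw
  refine hk.ne' (tendsto_nhds_unique (hw (top m)) ?_)
  obtain ⟨B, hB⟩ := hfin.bddAbove
  have : ∀ r, Nat.count (fun p => w p = top m) r ≤ B + 1 := by
    intro r
    rcases le_total r (B + 1) with h | h
    · exact (Nat.count_le _).trans h
    · obtain ⟨d, rfl⟩ := Nat.exists_eq_add_of_le h
      rw [Nat.count_add]
      have : Nat.count (fun k => w (B + 1 + k) = top m) d = 0 := by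
        rw [Nat.count_iff_forall_not]
        intro k _ hc
        have := hB (show B + 1 + k ∈ {p | w p = top m} from hc)
        omega
      rw [this]
      exact Nat.count_le _
  refine tendsto_div_of_bounded_discrepancy (B := B + 1) 0 fun r _ => ?_
  rw [mul_zero, sub_zero, abs_of_nonneg (Nat.cast_nonneg _)]
  exact_mod_cast this r

theorem infinite_ne_one {w : Seq m} (h : {p | w p = top m}.Infinite) :
    {p | w p ≠ one m}.Infinite :=
  h.mono fun p (hp : w p = top m) => by
    change w p ≠ one m
    rw [hp]; exact one_ne_top.symm

/-- Unmatched `k`s have density `(n + 1) α_k - α_1`; the matched ones, decoded to `k - 1`, have the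
remaining density `α_1 - n α_k`. Erasing the letters `1` divides all densities by `1 - α_1`. -/
theorem desubst_mem_seqsWithProportions {α : Letter m → ℝ} (hα : α ∈ simplex m) {w : Seq m}
    (hw : w ∈ seqsWithProportions α) {n : ℕ} (hn : α (one m) < (n + 1) * α (top m))
    (hf : ∀ p, w p = top m → ∀ i, 0 < i → i ≤ n → w (p + i) = one m) :
    desubst n w ∈ seqsWithProportions (Kn n α) := by
  have hinf := infinite_ne_one (infinite_top hα.2.1 hw)
  have hU := tendsto_count_unmatched hw hn hf
  have hD : 0 < 1 - α (one m) := by have := simplex_one_lt hα; linarith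
  have hw' := mem_seqsWithProportions.1 hw
  have hnon : Tendsto (fun q : ℕ => (countNonOne w q : ℝ) / q) atTop (𝓝 (1 - α (one m))) := by
    refine ((hw' (one m)).const_sub 1).congr' ?_
    filter_upwards [eventually_gt_atTop 0] with q hq
    have hq' : (0 : ℝ) < q := by exact_mod_cast hq
    have : (Nat.count (fun p => w p = one m) q : ℝ) + countNonOne w q = q := by
      exact_mod_cast countNonOne_add w q
    field_simp
    linarith
  have hnum : ∀ i, Tendsto (fun q : ℕ =>
      (Nat.count (fun p => w p ≠ one m ∧ desubstLetter n w p = i) q : ℝ) / q) atTop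
      (𝓝 (Kn n α i * (1 - α (one m)))) := by
    intro i
    rcases lt_trichotomy (i : ℕ) m with h | h | h
    · have e : i = ⟨(i : ℕ), by omega⟩ := rfl
      rw [e, Kn_of_lt n α h, div_mul_cancel₀ _ hD.ne']
      refine (hw' ⟨(i : ℕ) + 1, by omega⟩).congr fun q => ?_
      congr 3
      funext p
      refine propext ⟨fun hp => ?_, fun hp => ?_⟩
      · have hnu : ¬ IsUnmatched n w p := fun hu => by
          have := congrArg Fin.val (hp.symm.trans hu.1)
          simp at this; omega
        refine ⟨fun hc => ?_, Fin.ext ?_⟩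
        · rw [hc] at hp; exact Nat.succ_ne_zero _ (congrArg Fin.val hp).symm
        · rw [desubstLetter_val_of_not_unmatched hnu, hp]; simp
      · obtain ⟨hp1, hp2⟩ := hp
        have hnu : ¬ IsUnmatched n w p := fun hu => by
          rw [desubstLetter_eq_top_iff.2 hu] at hp2
          have := congrArg Fin.val hp2
          simp at this; omega
        have h3 := desubstLetter_val_of_not_unmatched hnu
        rw [hp2] at h3
        simp only at h3
        have h4 : (w p : ℕ) ≠ 0 := fun h => hp1 (Fin.ext h)
        exact Fin.ext (by simp only; omega)
    · have e : i = ⟨m, by omega⟩ := Fin.ext h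
      rw [e, Kn_eq, div_mul_cancel₀ _ hD.ne']
      have h1 := (hw' (top m)).sub hU
      rw [show α (top m) - ((n + 1) * α (top m) - α (one m)) = α (one m) - n * α (top m) by ring]
        at h1
      refine h1.congr fun q => ?_
      rw [← sub_div]
      congr 1
      rw [sub_eq_iff_eq_add]
      norm_cast
      induction q with
      | zero => simp
      | succ q ih =>
        rw [Nat.count_succ, Nat.count_succ, Nat.count_succ]
        have h2 := (w q).2
        by_cases ht : w q = top m
        · have h1 : w q ≠ one m := by rw [ht]; exact one_ne_top.symm
          by_cases hu : IsUnmatched n w q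
          · have h3 : desubstLetter n w q ≠ ⟨m, by omega⟩ := by
              rw [desubstLetter_eq_top_iff.2 hu]
              exact Fin.ne_of_val_ne (by simp)
            rw [if_pos ht, if_neg (fun h => h3 h.2), if_pos ⟨h1, desubstLetter_eq_top_iff.2 hu⟩]
            omega
          · have h3 : desubstLetter n w q = ⟨m, by omega⟩ :=
              Fin.ext (by rw [desubstLetter_val_of_not_unmatched hu, ht]; simp)
            rw [if_pos ht, if_pos ⟨h1, h3⟩, if_neg (fun h => hu (desubstLetter_eq_top_iff.1 h.2))]
            omega
        · have hu : ¬ IsUnmatched n w q := fun h => ht h.1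
          have h3 : ¬ (w q ≠ one m ∧ desubstLetter n w q = ⟨m, by omega⟩) := by
            rintro ⟨h3, h4⟩
            have h5 := desubstLetter_val_of_not_unmatched hu
            rw [h4] at h5
            have h6 : (w q : ℕ) ≠ 0 := fun h => h3 (Fin.ext h)
            simp only at h5
            exact ht (eq_top_of_lt (by omega))
          rw [if_neg ht, if_neg h3, if_neg (fun h => hu (desubstLetter_eq_top_iff.1 h.2))]
          omega
    · rw [eq_top_of_lt h, Kn_top, div_mul_cancel₀ _ hD.ne']
      exact hU
  rw [mem_seqsWithProportions]
  intro i
  have h1 := (hnum i).div hnon hD.ne'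
  rw [mul_div_cancel_right₀ _ hD.ne'] at h1
  have hnth : Tendsto (Nat.nth (fun p => w p ≠ one m)) atTop atTop :=
    (Nat.nth_strictMono hinf).tendsto_atTop
  have h2 := h1.comp hnth
  refine h2.congr' ?_
  filter_upwards [hnth.eventually_gt_atTop 0] with j hj
  have hj' : (0 : ℝ) < (Nat.nth (fun p => w p ≠ one m) j : ℝ) := by exact_mod_cast hj
  have hcj : countNonOne w (Nat.nth (fun p => w p ≠ one m) j) = j := Nat.count_nth_of_infinite hinf j
  have h3 := count_desubst n w i (Nat.nth (fun p => w p ≠ one m) j)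
  rw [hcj] at h3
  simp only [Function.comp_apply, Pi.div_apply, hcj]
  rw [← h3]
  exact div_div_div_cancel_right₀ hj'.ne' _ _

theorem countNonOne_next {w : Seq m} {q L : ℕ} (hq : w q ≠ one m) (hL : 0 < L)
    (h : ∀ i, 0 < i → i < L → w (q + i) = one m) : countNonOne w (q + L) = countNonOne w q + 1 := by
  induction L, hL using Nat.le_induction with
  | base =>
    change Nat.count (fun p => w p ≠ one m) (q + 1) = _
    rw [Nat.count_succ, if_pos hq]
  | succ L hL ih =>
    rw [← Nat.add_assoc, countNonOne, Nat.count_succ, if_neg (not_not.2 (h L hL (by omega)))]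
    exact ih fun i h0 hi => h i h0 (by omega)

theorem substSeq_zero_of_desubstLetter {n : ℕ} {w v : Seq m} {q : ℕ} (hq : w q ≠ one m)
    (hv : v 0 = desubstLetter n w q) : substSeq n v 0 = w q := by
  have h1 : (w q : ℕ) ≠ 0 := fun h => hq (Fin.ext h)
  have h2 := (w q).2
  by_cases hu : IsUnmatched n w q
  · rw [substSeq_zero_of_le n v (by rw [hv, desubstLetter_eq_top_iff.2 hu]; simp), hu.1]
  have h3 := desubstLetter_val_of_not_unmatched hu
  rw [← hv] at h3
  rcases lt_or_ge (v 0 : ℕ) m with h | h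
  · rw [substSeq_zero_of_lt n v h]
    exact Fin.ext (by simp only; omega)
  · rw [substSeq_zero_of_le n v h, eq_top_of_lt (i := w q) (by omega)]

/-- Coinduction along positions where the excess attains its maximum over the future. Either the
decoded block is really present in `w` and ends at another such position, or a matched `k` lacks its
`(n + 1)`-st `1` and `w` is strictly larger. -/
theorem substSeq_desubst_le {n : ℕ} {w : Seq m} {q : ℕ}
    (hf : ∀ p, w p = top m → ∀ i, 0 < i → i ≤ n → w (p + i) = one m)
    (hq : w q ≠ one m) (hmax : ∀ q' ≥ q, excess n w q' ≤ excess n w q) :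
    toLex (substSeq n (shift^[countNonOne w q] (desubst n w))) ≤ toLex (shift^[q] w) := by
  refine lex_le_of_coinduction (fun x y => ∃ q, w q ≠ one m ∧
    (∀ q' ≥ q, excess n w q' ≤ excess n w q) ∧
    x = substSeq n (shift^[countNonOne w q] (desubst n w)) ∧ y = shift^[q] w) ?_
    ⟨q, hq, hmax, rfl, rfl⟩
  clear hq hmax q
  rintro _ _ ⟨q, hq, hmax, rfl, rfl⟩
  set v := shift^[countNonOne w q] (desubst n w) with hv
  have hv0 : v 0 = desubstLetter n w q := by
    rw [hv, shift_iterate_apply, Nat.add_zero, desubst_count n hq]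
  have hzero := substSeq_zero_of_desubstLetter hq hv0
  have hx0 : shift^[q] w 0 = w q := by rw [shift_iterate_apply, Nat.add_zero]
  have next : ∀ L, blockLength n (v 0) = L → (∀ i, 0 < i → i < L → w (q + i) = one m) →
      w (q + L) ≠ one m → (∀ q' ≥ q + L, excess n w q' ≤ excess n w (q + L)) →
      ∃ L, 0 < L ∧ (∀ i < L, substSeq n v i = shift^[q] w i) ∧ ∃ q', w q' ≠ one m ∧
        (∀ q'' ≥ q', excess n w q'' ≤ excess n w q') ∧
        shift^[L] (substSeq n v) = substSeq n (shift^[countNonOne w q'] (desubst n w)) ∧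
        shift^[L] (shift^[q] w) = shift^[q'] w := by
    intro L hL h1 h2 h3
    have hL0 : 0 < L := hL ▸ blockLength_pos n (v 0)
    refine ⟨L, hL0, fun i hi => ?_, q + L, h2, h3, ?_, ?_⟩
    · rw [shift_iterate_apply]
      rcases Nat.eq_zero_or_pos i with rfl | hi0
      · exact hzero
      · rw [h1 i hi0 hi, substSeq_eq_one n v hi0 (hL ▸ hi)]
    · rw [countNonOne_next hq hL0 h1, Function.iterate_succ_apply', ← hv, ← hL, shift_substSeq]
    · rw [← Function.iterate_add_apply, Nat.add_comm]
  by_cases ht : w q = top m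
  · have hones := hf q ht
    have hblock : excess n w (q + (n + 1)) = excess n w q - 1 := excess_block hf ht
    by_cases hu : IsUnmatched n w q
    · refine Or.inr (next (n + 1) (by rw [hv0, desubstLetter_eq_top_iff.2 hu, blockLength_top])
        (fun i h0 hi => hones i h0 (by omega)) (fun hc => ?_) fun q' hq' => ?_)
      -- One more `1` would restore the excess at `q`, contradicting that this `k` is unmatched.
      · have h1 := excess_succ_one n hc
        have h2 := hu.2 (q + (n + 1) + 1) (by omega)
        omega
      · have := hu.2 q' (by omega)
        omega
    · have hval : (v 0 : ℕ) = m := by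
        rw [hv0, desubstLetter_val_of_not_unmatched hu, ht]; simp
      by_cases hc : w (q + (n + 1)) = one m
      · have h1 : excess n w (q + (n + 2)) = excess n w (q + (n + 1)) + 1 := excess_succ_one n hc
        refine Or.inr (next (n + 2) (blockLength_of_eq n hval) (fun i h0 hi => ?_) (fun hc' => ?_)
          fun q' hq' => ?_)
        · rcases (show i ≤ n + 1 by omega).eq_or_lt with rfl | h
          · exact hc
          · exact hones i h0 (by omega)
        · have h2 := excess_succ_one n hc'
          have h3 := hmax (q + (n + 2) + 1) (by omega)
          omega
        · have := hmax q' (by omega)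
          omega
      · refine Or.inl (lex_lt_of_ones (n + 1) (hx0.trans ht) (Or.inr fun i h0 hi =>
          substSeq_eq_one n v h0 (by rw [blockLength_of_eq n hval]; omega))
          ⟨n + 1, by omega, le_rfl, ?_⟩)
        rwa [shift_iterate_apply]
  · have hu : ¬ IsUnmatched n w q := fun h => ht h.1
    have h0 : excess n w (q + 1) = excess n w q := excess_succ_other n hq ht
    have hval : (v 0 : ℕ) < m := by
      rw [hv0, desubstLetter_val_of_not_unmatched hu]
      have h1 : (w q : ℕ) ≠ 0 := fun h => hq (Fin.ext h)
      by_contra hc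
      exact ht (eq_top_of_lt (by omega))
    refine Or.inr (next 1 (blockLength_of_lt n hval) (fun i _ _ => by omega) (fun hc => ?_)
      fun q' hq' => ?_)
    · have h2 := excess_succ_one n hc
      have h3 := hmax (q + 1 + 1) (by omega)
      omega
    · rw [h0]; exact hmax q' (by omega)

theorem exists_unmatched {α : Letter m → ℝ} {w : Seq m} (hw : w ∈ seqsWithProportions α)
    {n : ℕ} (hn : α (one m) < (n + 1) * α (top m))
    (hf : ∀ p, w p = top m → ∀ i, 0 < i → i ≤ n → w (p + i) = one m) :
    ∃ p, IsUnmatched n w p := by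
  by_contra! hc
  have h0 : ∀ q, Nat.count (fun p => w p ≠ one m ∧ desubstLetter n w p = top m) q = 0 := fun q =>
    Nat.count_iff_forall_not.2 fun p _ h => hc p (desubstLetter_eq_top_iff.1 h.2)
  have h1 := tendsto_count_unmatched hw hn hf
  simp only [h0, Nat.cast_zero, zero_div] at h1
  have := tendsto_nhds_unique h1 tendsto_const_nhds
  linarith

theorem lt_J_add_one_mul {α : Letter m → ℝ} (hα : α ∈ simplex m) :
    α (one m) < ((J α : ℝ) + 1) * α (top m) := by
  have := Nat.lt_floor_add_one (α (one m) / α (top m))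
  rwa [div_lt_iff₀ hα.2.1] at this

theorem exists_desubstitution {α : Letter m → ℝ} (hα : α ∈ simplex m) {w : Seq m}
    (hw : w ∈ seqsWithProportions α) :
    ∃ w' ∈ seqsWithProportions (K α), ∀ j, ∃ i,
      toLex (substSeq (J α) (shift^[j] w')) ≤ toLex (shift^[i] w) := by
  have hn := lt_J_add_one_mul hα
  set n := J α with hJ
  by_cases hf : ∀ p, w p = top m → ∀ i, 0 < i → i ≤ n → w (p + i) = one m
  · refine ⟨desubst n w, desubst_mem_seqsWithProportions hα hw hn hf, fun j => ?_⟩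
    have hinf := infinite_ne_one (infinite_top hα.2.1 hw)
    obtain ⟨q, hq, hqj⟩ : ∃ q, w q ≠ one m ∧ countNonOne w q = j :=
      ⟨_, Nat.nth_mem_of_infinite hinf j, Nat.count_nth_of_infinite hinf j⟩
    subst hqj
    by_cases hu : IsUnmatched n w q
    · refine ⟨q, substSeq_desubst_le hf hq fun q' hq' => ?_⟩
      rcases hq'.eq_or_lt with rfl | h
      · exact le_rfl
      · exact (hu.2 _ h).le
    -- The decoded letter is not `k`, so its image begins below `k` or with `k 1^(n+1)`. A tail of
    -- `w` starting at an unmatched `k` has something other than `1` after `k 1^n` and beats both.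
    · obtain ⟨p, hp⟩ := exists_unmatched hw hn hf
      have hv0 : shift^[countNonOne w q] (desubst n w) 0 = desubstLetter n w q := by
        rw [shift_iterate_apply, Nat.add_zero, desubst_count n hq]
      have hval := desubstLetter_val_of_not_unmatched hu
      rw [← hv0] at hval
      have h2 := (w q).2
      refine ⟨p, (lex_lt_of_ones (n + 1) (by rw [shift_iterate_apply]; exact hp.1) ?_
        ⟨n + 1, by omega, le_rfl, fun hc => ?_⟩).le⟩
      · rcases lt_or_ge (shift^[countNonOne w q] (desubst n w) 0 : ℕ) m with h | h
        · left
          rw [substSeq_zero_of_lt n _ h]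
          exact Fin.ne_of_val_ne (by simp only [Fin.val_last]; omega)
        · exact Or.inr fun i h0 hi => substSeq_eq_one n _ h0
            (by rw [blockLength_of_eq n (by omega)]; omega)
      · rw [shift_iterate_apply] at hc
        have h3 := excess_succ_one n hc
        have h4 : excess n w (p + (n + 1)) = excess n w p - 1 := excess_block hf hp.1
        have h5 := hp.2 (p + (n + 1) + 1) (by omega)
        omega
  · push Not at hf
    obtain ⟨p, hp, i, h0, hi, hne⟩ := hf
    -- Every image block starting with `k` continues with `1^n`, so the tail of `w` at `p` exceeds
    -- all images and any `w'` with the right proportions will do.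
    obtain ⟨w', hw'⟩ := seqsWithProportions_nonempty (K_mapsTo m hα)
    refine ⟨w', hw', fun j => ⟨p, (lex_lt_of_ones n (by rw [shift_iterate_apply]; exact hp) ?_
      ⟨i, h0, hi, by rwa [shift_iterate_apply]⟩).le⟩⟩
    rcases lt_or_ge (shift^[j] w' 0 : ℕ) m with h | h
    · left
      rw [substSeq_zero_of_lt n _ h]
      exact Fin.ne_of_val_ne (by simp only [Fin.val_last]; omega)
    · refine Or.inr fun i h0 hi => substSeq_eq_one n _ h0 ?_
      rcases h.eq_or_lt with h | h
      · rw [blockLength_of_eq n h.symm]; omega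
      · rw [eq_top_of_lt h, blockLength_top]; omega

/-! ### Compositions of substitutions -/

/-- The composition `Λ_{n_0} ∘ ⋯ ∘ Λ_{n_{r-1}}` acting on sequences. -/
def substSeqComp (n : ℕ → ℕ) : ℕ → Seq m → Seq m
  | 0, w => w
  | r + 1, w => substSeqComp n r (substSeq (n r) w)

theorem substSeqComp_mono (n : ℕ → ℕ) (r : ℕ) {v w : Seq m} (h : toLex v ≤ toLex w) :
    toLex (substSeqComp n r v) ≤ toLex (substSeqComp n r w) := by
  induction r generalizing v w with
  | zero => exact h
  | succ r ih => exact ih (substSeq_mono _ h)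

theorem HasPrefix.substComp {W : List (Letter m)} {w : Seq m} (h : HasPrefix W w) (n : ℕ → ℕ)
    (r : ℕ) : HasPrefix (Infimax.substComp n r W) (substSeqComp n (r + 1) w) := by
  induction r generalizing W w with
  | zero => exact h.subst _
  | succ r ih => exact ih (h.subst _)

theorem length_le_length_substComp (n : ℕ → ℕ) (r : ℕ) (W : List (Letter m)) :
    W.length ≤ (substComp n r W).length := by
  induction r generalizing W with
  | zero => exact length_le_length_subst _ _
  | succ r ih => exact (length_le_length_subst _ _).trans (ih _)

theorem substComp_succ_top (n : ℕ → ℕ) (r : ℕ) :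
    substComp n (r + 1) [top m] = substComp n r [top m] ++
      substComp n r (List.replicate (n (r + 1)) (one m)) := by
  rw [substComp, subst_top, substComp_append]

theorem substComp_nil (n : ℕ → ℕ) (r : ℕ) : substComp n r ([] : List (Letter m)) = [] := by
  induction r with
  | zero => rfl
  | succ r ih => exact ih

theorem substComp_top_prefix_of_le (n : ℕ → ℕ) {r s : ℕ} (h : r ≤ s) :
    substComp n r [top m] <+: substComp n s [top m] := by
  induction s, h using Nat.le_induction with
  | base => exact List.prefix_rfl
  | succ s _ ih => exact ih.trans (substComp_top_prefix n s)

theorem eventually_repeatWord_eq_S (n : ℕ → ℕ) (j : ℕ) :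
    ∀ᶠ r in atTop, repeatWord (substComp n r [top m]) j = S n j :=
  (tendsto_pi_nhds.1 (tendsto_S n) j).eventually_mem
    ((isOpen_discrete {S n j}).mem_nhds rfl)

theorem hasPrefix_S (n : ℕ → ℕ) (r : ℕ) : HasPrefix (substComp n r [top m]) (S n) := by
  refine hasPrefix_of_getElem fun j hj => ?_
  obtain ⟨s, hs, hrs⟩ := ((eventually_repeatWord_eq_S n j).and (eventually_ge_atTop r)).exists
  have hp := substComp_top_prefix_of_le (m := m) n hrs
  have hl := hj.trans_le hp.length_le
  rw [← hs, repeatWord, Nat.mod_eq_of_lt hl, List.getD_eq_getElem _ _ hl]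
  exact hp.getElem hj

/-- `Λ_0` fixes `k`, so the defining words are constant from `R` on. -/
theorem S_eq_repeatWord {n : ℕ → ℕ} {R : ℕ} (h : ∀ s ≥ R, n s = 0) :
    S n = repeatWord (substComp n R [top m]) := by
  have hc : ∀ s ≥ R, substComp n s [top m] = substComp n R [top m] := by
    intro s hs
    induction s, hs using Nat.le_induction with
    | base => rfl
    | succ s hs ih =>
      rw [substComp_succ_top, h (s + 1) (by omega), List.replicate_zero, substComp_nil,
        List.append_nil, ih]
  funext j
  obtain ⟨s, hs, hRs⟩ := ((eventually_repeatWord_eq_S n j).and (eventually_ge_atTop R)).exists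
  rw [← hs, hc s hRs]

theorem HasPrefix.append {V W : List (Letter m)} {w : Seq m} (hV : HasPrefix V w)
    (hW : HasPrefix W (shift^[V.length] w)) : HasPrefix (V ++ W) w := by
  refine hasPrefix_of_getElem fun j hj => ?_
  rw [List.length_append] at hj
  rcases lt_or_ge j V.length with h | h
  · rw [List.getElem_append_left h, hV.getElem h]
  · rw [List.getElem_append_right h, hW.getElem (by omega), shift_iterate_apply]
    congr 1; omega

theorem hasPrefix_repeatWord (W : List (Letter m)) : HasPrefix W (repeatWord W) :=
  hasPrefix_of_getElem fun j hj => by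
    rw [repeatWord, Nat.mod_eq_of_lt hj, List.getD_eq_getElem _ _ hj]

theorem hasPrefix_substComp_replicate (n : ℕ → ℕ) (R N : ℕ) :
    HasPrefix (substComp n R (List.replicate N (top m)))
      (repeatWord (substComp n R [top m])) := by
  induction N with
  | zero => rw [List.replicate_zero, substComp_nil]; rfl
  | succ N ih =>
    rw [List.replicate_succ, ← List.singleton_append, substComp_append]
    refine (hasPrefix_repeatWord _).append ?_
    convert ih using 1
    funext j
    rw [shift_iterate_apply, repeatWord, repeatWord, Nat.add_mod_left]

theorem HasPrefix.eq_of_lt {W : List (Letter m)} {v w : Seq m} (hv : HasPrefix W v)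
    (hw : HasPrefix W w) {j : ℕ} (hj : j < W.length) : v j = w j := by
  rw [← hv.getElem hj, hw.getElem hj]

theorem hasPrefix_replicate_top {N : ℕ} {x : Seq m} (hx : ∀ i < N, x i = top m) :
    HasPrefix (List.replicate N (top m)) x :=
  hasPrefix_of_getElem fun j hj => by
    rw [List.getElem_replicate, hx j (by simpa using hj)]

/-! ### Itineraries -/

theorem iterate_K_mem {α : Letter m → ℝ} (hα : α ∈ simplex m) (r : ℕ) : K^[r] α ∈ simplex m :=
  (K_mapsTo m).iterate r hα

/-- Control of all tails is what makes the induction run: the bound at one level is by an arbitrary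
tail of the intermediate sequence. -/
theorem exists_desubstitution_iterate {α : Letter m → ℝ} (hα : α ∈ simplex m) {w : Seq m}
    (hw : w ∈ seqsWithProportions α) (r : ℕ) :
    ∃ w' ∈ seqsWithProportions (K^[r] α), ∀ j, ∃ i,
      toLex (substSeqComp (itinerary α) r (shift^[j] w')) ≤ toLex (shift^[i] w) := by
  induction r with
  | zero => exact ⟨w, hw, fun j => ⟨j, le_rfl⟩⟩
  | succ r ih =>
    obtain ⟨v, hv, hvw⟩ := ih
    obtain ⟨v', hv', hle⟩ := exists_desubstitution (iterate_K_mem hα r) hv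
    rw [← Function.iterate_succ_apply' K] at hv'
    refine ⟨v', hv', fun j => ?_⟩
    obtain ⟨i, hi⟩ := hle j
    obtain ⟨i', hi'⟩ := hvw i
    exact ⟨i', (substSeqComp_mono _ r hi).trans hi'⟩

theorem IsMaximalSeq.begins_with_run {w : Seq m} (hw : IsMaximalSeq w) {j N : ℕ}
    (h : ∀ i < N, w (j + i) = top m) : ∀ i < N, w i = top m := by
  by_contra! hc
  classical
  obtain ⟨h1, h2⟩ := Nat.find_spec hc
  refine not_lt.2 (hw j) (lex_lt_iff.2 ⟨Nat.find hc, fun i hi => ?_, ?_⟩)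
  · have := Nat.find_min hc hi
    rw [shift_iterate_apply, h i (by omega)]
    by_contra hne
    exact this ⟨by omega, hne⟩
  · have e : shift^[j] w (Nat.find hc) = top m := by rw [shift_iterate_apply, h _ h1]
    exact (lt_of_le_of_ne (Fin.le_last _) h2).trans_eq e.symm

/-- If each window of length `N` contained a letter other than `k`, the proportion of `k` could not
exceed `1 - 1 / N`. -/
theorem exists_run {α : Letter m → ℝ} (hk : 0 < α (top m)) {w : Seq m}
    (hw : w ∈ seqsWithProportions α) {N : ℕ} (hN : N = 1 ∨ α (top m) = 1) :
    ∃ j, ∀ i < N, w (j + i) = top m := by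
  rcases hN with rfl | h1
  · obtain ⟨j, hj⟩ := (infinite_top hk hw).nonempty
    exact ⟨j, fun i hi => by rw [show i = 0 by omega]; exact hj⟩
  by_contra! hc
  have hN : 0 < N := by obtain ⟨i, hi, _⟩ := hc 0; omega
  have hcount : ∀ j, Nat.count (fun p => w p = top m) (j * N) + j ≤ j * N := by
    intro j
    induction j with
    | zero => simp
    | succ j ih =>
      have hlt : Nat.count (fun i => w (j * N + i) = top m) N < N := by
        refine lt_of_le_of_ne (Nat.count_le _) fun he => ?_
        obtain ⟨i, hi, hne⟩ := hc (j * N)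
        exact hne (Nat.count_iff_forall.1 he i hi)
      rw [Nat.succ_mul, Nat.count_add]
      omega
  have hmul : Tendsto (fun j : ℕ => j * N) atTop atTop :=
    tendsto_atTop_mono (fun j => Nat.le_mul_of_pos_right j hN) tendsto_id
  have ht := (mem_seqsWithProportions.1 hw (top m)).comp hmul
  rw [h1] at ht
  have hN' : (0 : ℝ) < N := by exact_mod_cast hN
  have hle : (1 : ℝ) ≤ 1 - 1 / N := by
    refine le_of_tendsto ht ?_
    filter_upwards [eventually_gt_atTop 0] with j hj
    have hj' : (0 : ℝ) < j := by exact_mod_cast hj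
    have h2 : (Nat.count (fun p => w p = top m) (j * N) : ℝ) + j ≤ j * N := by
      exact_mod_cast hcount j
    simp only [Function.comp_apply]
    push_cast
    rw [div_le_iff₀ (by positivity)]
    have : (1 - 1 / (N : ℝ)) * (j * N) = j * N - j := by field_simp
    linarith
  have : 0 < 1 / (N : ℝ) := by positivity
  linarith

theorem substSeqComp_mem_maximalSeqs {α : Letter m → ℝ} (hα : α ∈ simplex m) (r : ℕ) {w : Seq m}
    (hw : w ∈ maximalSeqs (K^[r] α)) : substSeqComp (itinerary α) r w ∈ maximalSeqs α := by
  induction r generalizing w with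
  | zero => exact hw
  | succ r ih =>
    obtain ⟨h1, h2⟩ := hw
    obtain ⟨j, hj⟩ := exists_run (iterate_K_mem hα (r + 1)).2.1 h2 (Or.inl rfl)
    have h0 := h1.begins_with_run hj 0 one_pos
    refine ih ⟨h1.substSeq h0 _, ?_⟩
    rw [Function.iterate_succ_apply'] at h2
    exact substSeq_mem_seqsWithProportions (simplex_one_lt (iterate_K_mem hα r)) h2

/-! ### Zero itineraries and approximation of `S`. -/

/-- With `J = 0`, `K β` is proportional to `(β_2, …, β_{k-1}, β_1, β_k - β_1)`. The bound `t β_1 ≤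
β_k - β_1` for `K β` improves `t` to `t + 1` for the first coordinate of `β`, and the shift of
coordinates passes this on to the others. -/
theorem nat_mul_le_top_of_itinerary_eq_zero (t : ℕ) {β : Letter m → ℝ} (hβ : β ∈ simplex m)
    (h : ∀ r, itinerary β r = 0) (v : ℕ) (hv : v < m + 1) :
    (t : ℝ) * β ⟨v, by omega⟩ ≤ β (top m) := by
  induction t generalizing β v with
  | zero => simpa using hβ.2.1.le
  | succ t iht =>
    induction v generalizing β with
    | zero =>
      have hK : K β = Kn 0 β := by rw [K, show J β = 0 from h 0]
      have hD : 0 < 1 - β (one m) := by have := simplex_one_lt hβ; linarith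
      have h1 := iht (K_mapsTo m hβ) (fun r => h (r + 1)) m (by omega)
      rw [hK, Kn_eq, Kn_top, mul_div_assoc', div_le_div_iff_of_pos_right hD] at h1
      change ((t + 1 : ℕ) : ℝ) * β (one m) ≤ β (top m)
      push_cast at h1 ⊢
      linarith
    | succ v ihv =>
      have hK : K β = Kn 0 β := by rw [K, show J β = 0 from h 0]
      have hD : 0 < 1 - β (one m) := by have := simplex_one_lt hβ; linarith
      have h1 := ihv (K_mapsTo m hβ) (fun r => h (r + 1)) (by omega)
      rw [hK, Kn_of_lt 0 β (by omega), Kn_top, mul_div_assoc',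
        div_le_div_iff_of_pos_right hD] at h1
      have h2 := hβ.1 (one m)
      push_cast at h1 ⊢
      linarith

theorem top_eq_one_of_itinerary_eq_zero {β : Letter m → ℝ} (hβ : β ∈ simplex m)
    (h : ∀ r, itinerary β r = 0) : β (top m) = 1 := by
  have h0 : ∀ i, i ≠ top m → β i = 0 := by
    intro i hi
    have hi' : (i : ℕ) < m + 1 := by
      by_contra hc
      exact hi (eq_top_of_lt (by omega))
    refine le_antisymm ?_ (hβ.1 i)
    by_contra! hc
    obtain ⟨t, ht⟩ := exists_nat_gt (β (top m) / β i)
    rw [div_lt_iff₀ hc] at ht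
    exact not_lt.2 (nat_mul_le_top_of_itinerary_eq_zero t hβ h i hi') ht
  rw [← hβ.2.2]
  exact (Finset.sum_eq_single _ (fun i _ hi => h0 i hi) (by simp)).symm

theorem itinerary_iterate (α : Letter m → ℝ) (R r : ℕ) :
    itinerary (K^[R] α) r = itinerary α (r + R) := by
  rw [itinerary, itinerary, ← Function.iterate_add_apply]

theorem exists_lt_length_substComp {n : ℕ → ℕ} (h : ∀ R, ∃ s ≥ R, n s ≠ 0) (d : ℕ) :
    ∃ r, d < (substComp n r [top m]).length := by
  induction d with
  | zero => exact ⟨0, length_le_length_substComp n 0 [top m]⟩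
  | succ d ih =>
    obtain ⟨r, hr⟩ := ih
    obtain ⟨s, hs, hns⟩ := h (r + 1)
    obtain ⟨s, rfl⟩ := Nat.exists_eq_add_of_le' (show 1 ≤ s by omega)
    refine ⟨s + 1, ?_⟩
    have h1 := (substComp_top_prefix_of_le (m := m) n (show r ≤ s by omega)).length_le
    have h2 := length_le_length_substComp n s (List.replicate (n (s + 1)) (one m))
    rw [List.length_replicate] at h2
    rw [substComp_succ_top, List.length_append]
    omega

/-- If the itinerary has infinitely many nonzero entries, the image of a single `k` grows without
bound and `N = 1` suffices. If it is eventually zero, that image stops growing and `S` is periodic,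
so a run of `d + 1` letters `k` is used; such runs are available because `K^[r] α` is then
concentrated on `k`. -/
theorem exists_agree_S {α : Letter m → ℝ} (hα : α ∈ simplex m) (d : ℕ) :
    ∃ r N, (N = 1 ∨ (K^[r] α) (top m) = 1) ∧ ∀ x : Seq m, (∀ i < N, x i = top m) →
      ∀ j ≤ d, substSeqComp (itinerary α) r x j = S (itinerary α) j := by
  by_cases h : ∃ R, ∀ s ≥ R, itinerary α s = 0
  · obtain ⟨R, hR⟩ := h
    refine ⟨R + 1, d + 1, Or.inr (top_eq_one_of_itinerary_eq_zero (iterate_K_mem hα _) fun r => ?_),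
      fun x hx j hj => ?_⟩
    · rw [itinerary_iterate]; exact hR _ (by omega)
    · rw [S_eq_repeatWord hR]
      have hl := length_le_length_substComp (itinerary α) R (List.replicate (d + 1) (top m))
      rw [List.length_replicate] at hl
      exact ((hasPrefix_replicate_top hx).substComp _ R).eq_of_lt
        (hasPrefix_substComp_replicate _ R (d + 1)) (by omega)
  · push Not at h
    obtain ⟨r, hr⟩ := exists_lt_length_substComp (m := m) h d
    exact ⟨r + 1, 1, Or.inl rfl, fun x hx j hj =>
      ((hasPrefix_replicate_top hx).substComp _ r).eq_of_lt (hasPrefix_S _ r) (by simpa using by omega)⟩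

end Infimax

/-- For every `k = m + 2 ≥ 2` and every `α` in the simplex, the set of maximal sequences with
letter proportions `α` is nonempty and its lexicographic infimum is `S(Φ(α))`. -/
theorem mainTheorem1 (m : ℕ) (α : Infimax.Letter m → ℝ) (hα : α ∈ Infimax.simplex m) :
    (Infimax.maximalSeqs α).Nonempty ∧
      IsGLB (toLex '' Infimax.maximalSeqs α) (toLex (Infimax.S (Infimax.itinerary α))) := by
  open Infimax in
  refine ⟨maximalSeqs_nonempty hα, ?_, ?_⟩
  · rintro _ ⟨w, ⟨hmax, hw⟩, rfl⟩
    by_contra hlt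
    obtain ⟨d, heq, hd⟩ := lex_lt_iff.1 (not_le.1 hlt)
    obtain ⟨r, N, hN, hag⟩ := exists_agree_S hα d
    obtain ⟨w', hw', hle⟩ := exists_desubstitution_iterate hα hw r
    obtain ⟨j, hj⟩ := exists_run (iterate_K_mem hα r).2.1 hw' hN
    obtain ⟨i, hi⟩ := hle j
    have hag' := hag (shift^[j] w') fun i hi => by rw [shift_iterate_apply]; exact hj i hi
    -- The image agrees with `S` through the place `d` where `w` drops below `S`, so it exceeds `w`;
    -- yet it is at most a tail of `w`, hence at most `w` by maximality.
    refine not_lt.2 (hi.trans (hmax i)) (lex_lt_iff.2 ⟨d, fun l hl => ?_, ?_⟩)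
    · rw [heq l hl, hag' l hl.le]
    · rw [hag' d le_rfl]; exact hd
  · intro v hv
    by_contra hlt
    obtain ⟨d, heq, hd⟩ := lex_lt_iff.1 (not_le.1 hlt)
    obtain ⟨r, N, hN, hag⟩ := exists_agree_S hα d
    obtain ⟨x, hx⟩ := maximalSeqs_nonempty (iterate_K_mem hα r)
    obtain ⟨j, hj⟩ := exists_run (iterate_K_mem hα r).2.1 hx.2 hN
    have hag' := hag x (hx.1.begins_with_run hj)
    -- This member of `maximalSeqs α` agrees with `S` through place `d`, so it lies below the
    -- supposed lower bound `v`.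
    refine not_lt.2 (hv ⟨_, substSeqComp_mem_maximalSeqs hα r hx, rfl⟩)
      (lex_lt_iff.2 ⟨d, fun l hl => ?_, ?_⟩)
    · rw [hag' l hl.le]; exact heq l hl
    · rw [hag' d le_rfl]; exact hd
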